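/- **Corollary.** *Setting.* Let $a_1,\dots,a_m\in\mathbb{R}^n$ be unit vectors, the rows of $A\in\mathbb{R}^{m\times n}$, and let $0<q<1$. Given $b\in\mathbb{R}^m$ and a current point $x_k\in\mathbb{R}^n$, one step of the $q$-quantile Random Kaczmarz method is the following: let $Q$ be the $q$-quantile of the $m$ numbers $|\langle x_k,a_i\rangle-b_i|$, that is, the least $t$ such that at least $qm$ of these numbers are $\le t$; choose an index $i$ uniformly at random from $\{i: |\langle x_k,a_i\rangle-b_i|\le Q\}$ (independently of the past given $x_k$); and set $x_{k+1}=x_k+(b_i-\langle a_i,x_k\rangle)a_i$. For $\beta\ge 0$ we say that the method *converges for all $\beta$-corruptions of $A$* if there is $c_{A,\beta,q}\in(0,1]$ such that for every $x\in\mathbb{R}^n$, with $b_t=Ax$, every $b\in\mathbb{R}^m$ that differs from $b_t$ in at most $\beta m$ entries, and every starting point $x_0\in\mathbb{R}^n$, the iterates satisfy $$\mathbb{E}\,\|x_k-x\|^2\le(1-c_{A,\beta,q})^k\,\|x_0-x\|^2\quad\text{for all }k\ge 0,\qquad\text{and}\qquad x_k\to x\ \text{ almost surely}.$$ *Statement.*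 For every $0<q<1$ there exist $\delta>0$, $\rho\in\mathbb{R}$, $N\in\mathbb{N}$ and $C,c>0$, all depending only on $q$, such that for all $m,n$ with $n\ge N$ and $m\ge\rho n$ the following holds: if the rows of $A\in\mathbb{R}^{m\times n}$ are drawn independently and uniformly from $\mathbb{S}^{n-1}$, then with probability at least $1-Ce^{-cm}$ the $q$-quantile Random Kaczmarz method converges for all $\beta$-corruptions of $A$, simultaneously for all $0\le\beta\le\delta$. -/

import Mathlib

open MeasureTheory ProbabilityTheory Filter Topology
open scoped ENNReal

noncomputable section

namespace QuantileKaczmarz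

/-- The (lower) `q`-quantile of `m` real numbers `y₁, …, y_m`: the least `t` such that at least
`q m` of the numbers are at most `t`. For `0 < q < 1` and `m ≥ 1` it is the `⌈q m⌉`-th smallest of
the numbers. -/
def quantile {m : ℕ} (q : ℝ) (y : Fin m → ℝ) : ℝ :=
  sInf {t : ℝ | q * m ≤ ((Finset.univ.filter fun i => y i ≤ t).card : ℝ)}

/-- The violation `|⟨x, aᵢ⟩ - bᵢ|` of each of the equations. The matrix `A` is given by its rows
`a₁, …, a_m`. -/
def residual {m n : ℕ} (a : Fin m → EuclideanSpace ℝ (Fin n)) (b : Fin m → ℝ)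
    (x : EuclideanSpace ℝ (Fin n)) (i : Fin m) : ℝ :=
  |inner ℝ x (a i) - b i|

/-- The indices of the equations in the `q`-quantile at the current point `x`. -/
def admissible {m n : ℕ} (q : ℝ) (a : Fin m → EuclideanSpace ℝ (Fin n)) (b : Fin m → ℝ)
    (x : EuclideanSpace ℝ (Fin n)) : Finset (Fin m) :=
  Finset.univ.filter fun i => residual a b x i ≤ quantile q (residual a b x)

/-- The Kaczmarz step: projection of `x` onto the hyperplane `⟨·, aᵢ⟩ = bᵢ` (for `‖aᵢ‖ = 1`). -/
def kaczmarzStep {m n : ℕ} (a : Fin m → EuclideanSpace ℝ (Fin n)) (b : Fin m → ℝ)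
    (x : EuclideanSpace ℝ (Fin n)) (i : Fin m) : EuclideanSpace ℝ (Fin n) :=
  x + (b i - inner ℝ (a i) x) • a i

/-- Law of the next iterate if the index is chosen uniformly from the finite set `T`. (If `T` is
empty the point does not move; the set of admissible equations is never empty for `m ≥ 1` and
`0 < q < 1`, so this only makes the definition total.) -/
def uniformStep {m n : ℕ} (a : Fin m → EuclideanSpace ℝ (Fin n)) (b : Fin m → ℝ)
    (T : Finset (Fin m)) (x : EuclideanSpace ℝ (Fin n)) : Measure (EuclideanSpace ℝ (Fin n)) :=
  if T = ∅ then Measure.dirac x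
  else (T.card : ℝ≥0∞)⁻¹ • ∑ i ∈ T, Measure.dirac (kaczmarzStep a b x i)

lemma measurable_quantile {m : ℕ} (q : ℝ) :
    Measurable (quantile q : (Fin m → ℝ) → ℝ) := by
  have hsub : ∀ (y : Fin m → ℝ) (t : ℝ),
      ((Finset.univ.filter fun i => y i ≤ t).card : ℝ) ≤ m := by
    intro y t
    have := Finset.card_le_univ (Finset.univ.filter fun i => y i ≤ t)
    simp only [Fintype.card_fin] at this
    exact_mod_cast this
  by_cases h0 : q * m ≤ 0
  · have : (quantile q : (Fin m → ℝ) → ℝ) = fun _ => 0 := by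
      funext y
      have : {t : ℝ | q * m ≤ ((Finset.univ.filter fun i => y i ≤ t).card : ℝ)} = Set.univ :=
        Set.eq_univ_of_forall fun t => h0.trans (Nat.cast_nonneg _)
      simp [quantile, this]
    rw [this]
    exact measurable_const
  by_cases h1 : (m : ℝ) < q * m
  · have : (quantile q : (Fin m → ℝ) → ℝ) = fun _ => 0 := by
      funext y
      have : {t : ℝ | q * m ≤ ((Finset.univ.filter fun i => y i ≤ t).card : ℝ)} = ∅ :=
        Set.eq_empty_of_forall_notMem fun t ht => absurd (ht.trans (hsub y t)) (not_le.2 h1)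
      simp [quantile, this]
    rw [this]
    exact measurable_const
  push Not at h0 h1
  refine measurable_of_Iio fun c => ?_
  have key : (quantile q : (Fin m → ℝ) → ℝ) ⁻¹' Set.Iio c =
      ⋃ r : {r : ℚ // (r : ℝ) < c},
        {y | q * m ≤ ((Finset.univ.filter fun i => y i ≤ (r.1 : ℝ)).card : ℝ)} := by
    ext y
    have hne : {t : ℝ | q * m ≤
        ((Finset.univ.filter fun i => y i ≤ t).card : ℝ)}.Nonempty := by
      refine ⟨∑ i, |y i|, ?_⟩
      have : (Finset.univ.filter fun i => y i ≤ ∑ i, |y i|) = Finset.univ := by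
        refine Finset.filter_true_of_mem fun i _ => (le_abs_self _).trans ?_
        exact Finset.single_le_sum (f := fun i => |y i|) (fun j _ => abs_nonneg _)
          (Finset.mem_univ i)
      simpa [this] using h1
    have hbdd : BddBelow {t : ℝ | q * m ≤
        ((Finset.univ.filter fun i => y i ≤ t).card : ℝ)} := by
      refine ⟨-∑ i, |y i|, fun t ht => ?_⟩
      have hpos : 0 < ((Finset.univ.filter fun i => y i ≤ t).card : ℝ) := h0.trans_le ht
      obtain ⟨i, hi⟩ := Finset.card_pos.1 (by exact_mod_cast hpos)
      have h2 : y i ≤ t := (Finset.mem_filter.1 hi).2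
      have h3 : |y i| ≤ ∑ i, |y i| :=
        Finset.single_le_sum (f := fun i => |y i|) (fun j _ => abs_nonneg _) (Finset.mem_univ i)
      have := neg_abs_le (y i)
      linarith
    simp only [Set.mem_preimage, Set.mem_Iio, quantile, csInf_lt_iff hbdd hne, Set.mem_iUnion,
      Set.mem_ofPred_eq]
    constructor
    · rintro ⟨t, ht, htc⟩
      obtain ⟨r, hr, hrc⟩ := exists_rat_btwn htc
      refine ⟨⟨r, hrc⟩, ht.trans ?_⟩
      exact_mod_cast Finset.card_le_card
        (Finset.monotone_filter_right _ fun i _ hi => le_trans hi hr.le)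
    · rintro ⟨⟨r, hrc⟩, hr⟩
      exact ⟨r, hr, hrc⟩
  rw [key]
  refine MeasurableSet.iUnion fun r => ?_
  have : Measurable fun y : Fin m → ℝ =>
      ((Finset.univ.filter fun i => y i ≤ (r.1 : ℝ)).card : ℝ) := by
    simp only [Finset.card_filter, Nat.cast_sum]
    refine Finset.measurable_sum _ fun i _ => ?_
    simp only [Nat.cast_ite]
    exact Measurable.ite (measurableSet_le (measurable_pi_apply i) measurable_const)
      measurable_const measurable_const
  exact measurableSet_le measurable_const this

lemma measurable_residual {m n : ℕ} (a : Fin m → EuclideanSpace ℝ (Fin n)) (b : Fin m → ℝ) :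
    Measurable (residual a b) := by
  refine measurable_pi_lambda _ fun i => Continuous.measurable ?_
  unfold residual
  fun_prop

lemma measurableSet_admissible {m n : ℕ} (q : ℝ) (a : Fin m → EuclideanSpace ℝ (Fin n))
    (b : Fin m → ℝ) (T : Finset (Fin m)) : MeasurableSet {x | admissible q a b x = T} := by
  have : {x | admissible q a b x = T} = ⋂ i, {x | residual a b x i ≤
      quantile q (residual a b x) ↔ i ∈ T} := by
    ext x
    simp [admissible, Finset.ext_iff]
  rw [this]
  refine MeasurableSet.iInter fun i => ?_
  have hm : MeasurableSet {x | residual a b x i ≤ quantile q (residual a b x)} :=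
    measurableSet_le ((measurable_pi_apply i).comp (measurable_residual a b))
      ((measurable_quantile q).comp (measurable_residual a b))
  by_cases hi : i ∈ T
  · simpa [hi] using hm
  · simp only [hi, iff_false]
    exact hm.compl

lemma measurable_uniformStep {m n : ℕ} (a : Fin m → EuclideanSpace ℝ (Fin n)) (b : Fin m → ℝ)
    (T : Finset (Fin m)) : Measurable (uniformStep a b T) := by
  have hstep : ∀ i, Measurable fun x => kaczmarzStep a b x i := fun i => by
    refine Continuous.measurable ?_
    unfold kaczmarzStep
    fun_prop
  refine Measure.measurable_of_measurable_coe _ fun s hs => ?_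
  by_cases hT : T = ∅
  · simp only [uniformStep, hT, if_true, Measure.dirac_apply' _ hs]
    exact measurable_one.indicator hs
  · simp only [uniformStep, hT, if_false, Measure.smul_apply, Measure.finsetSum_apply,
      Measure.dirac_apply' _ hs, smul_eq_mul]
    refine Measurable.const_mul (Finset.measurable_sum _ fun i _ => ?_) _
    exact (measurable_one.indicator hs).comp (hstep i)

/-- The transition kernel of the `q`-quantile Random Kaczmarz method for the system with rows `a`
and given right-hand side `b`: from `x`, choose an index uniformly among the admissible equations
at `x` and perform the Kaczmarz step for it. -/
def stepKernel {m n : ℕ} (q : ℝ) (a : Fin m → EuclideanSpace ℝ (Fin n)) (b : Fin m → ℝ) :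
    Kernel (EuclideanSpace ℝ (Fin n)) (EuclideanSpace ℝ (Fin n)) where
  toFun x := uniformStep a b (admissible q a b x) x
  measurable' := by
    refine Measure.measurable_of_measurable_coe _ fun s hs => ?_
    intro u hu
    have : (fun x => uniformStep a b (admissible q a b x) x s) ⁻¹' u =
        ⋃ T : Finset (Fin m), {x | admissible q a b x = T} ∩
          (fun x => uniformStep a b T x s) ⁻¹' u := by
      ext x
      simp
    rw [this]
    exact MeasurableSet.iUnion fun T => (measurableSet_admissible q a b T).inter
      (((Measure.measurable_coe hs).comp (measurable_uniformStep a b T)) hu)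

instance isMarkovKernel_stepKernel {m n : ℕ} (q : ℝ) (a : Fin m → EuclideanSpace ℝ (Fin n)) (b : Fin m → ℝ) :
    IsMarkovKernel (stepKernel q a b) := by
  refine ⟨fun x => ⟨?_⟩⟩
  change uniformStep a b (admissible q a b x) x Set.univ = 1
  by_cases hT : admissible q a b x = ∅
  · simp [uniformStep, hT]
  · simp only [uniformStep, hT, if_false, Measure.smul_apply, Measure.finsetSum_apply,
      measure_univ, smul_eq_mul, Finset.sum_const, nsmul_eq_mul, mul_one]
    exact ENNReal.inv_mul_cancel (by simpa using hT) (ENNReal.natCast_ne_top _)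

/-- The law, on the space of all sequences `(x_k)_{k ≥ 0}` in `ℝⁿ`, of the iterates of the
`q`-quantile Random Kaczmarz method started at `x₀`: the Markov chain with the above transition
kernel. -/
def iterates {m n : ℕ} (q : ℝ) (a : Fin m → EuclideanSpace ℝ (Fin n)) (b : Fin m → ℝ)
    (x₀ : EuclideanSpace ℝ (Fin n)) : Measure (ℕ → EuclideanSpace ℝ (Fin n)) :=
  Kernel.trajMeasure (X := fun _ => EuclideanSpace ℝ (Fin n)) (Measure.dirac x₀) fun k =>
    (stepKernel q a b).comap
      (fun h : (i : Finset.Iic k) → EuclideanSpace ℝ (Fin n) => h ⟨k, Finset.mem_Iic.2 le_rfl⟩)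
      (measurable_pi_apply _)

/-- The `q`-quantile Random Kaczmarz method with rows `a` converges for all `β`-corruptions: there
is a rate `c > 0` such that, for every system `⟨aᵢ, x⟩ = (b_t)ᵢ`, every `b` which differs from
`b_t` in at most `β m` entries and every starting point `x₀`, the iterates satisfy
`𝔼 ‖x_k - x‖² ≤ (1 - c)^k ‖x₀ - x‖²` for all `k`, and `x_k → x` almost surely. -/
def Converges {m n : ℕ} (q β : ℝ) (a : Fin m → EuclideanSpace ℝ (Fin n)) : Prop :=
  ∃ c : ℝ, 0 < c ∧ c ≤ 1 ∧
    ∀ (x : EuclideanSpace ℝ (Fin n)) (bt b : Fin m → ℝ) (x₀ : EuclideanSpace ℝ (Fin n)),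
      (∀ i, inner ℝ (a i) x = bt i) →
      ((Finset.univ.filter fun i => b i ≠ bt i).card : ℝ) ≤ β * m →
      (∀ k : ℕ, ∫⁻ ω, ENNReal.ofReal (‖ω k - x‖ ^ 2) ∂(iterates q a b x₀) ≤
        ENNReal.ofReal ((1 - c) ^ k * ‖x₀ - x‖ ^ 2)) ∧
      ∀ᵐ ω ∂(iterates q a b x₀), Tendsto ω atTop (𝓝 x)

/-- The uniform probability distribution on `S^{n-1}`: normalized surface measure. -/
def uniformSphere (n : ℕ) : Measure (Metric.sphere (0 : EuclideanSpace ℝ (Fin n)) 1) :=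
  ((volume : Measure (EuclideanSpace ℝ (Fin n))).toSphere Set.univ)⁻¹ •
    (volume : Measure (EuclideanSpace ℝ (Fin n))).toSphere

end QuantileKaczmarz

end

/-!
# Convergence of the quantile Random Kaczmarz method for random matrices

For a fixed matrix with unit rows in `ℝⁿ`, put `e = x_k - x`. A step along an uncorrupted equation
decreases `‖e‖²` by `⟨e, aᵢ⟩²`. A step along a corrupted equation may increase it, but an admissible
equation moves the point by at most the quantile `Q`, so the increase is at most
`2 Q |⟨e, aᵢ⟩| + Q²`. When the proportion of corruptions is small, two bounds therefore suffice for a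
contraction in mean square:

* `∑ ⟨e, aᵢ⟩² ≤ M (m / n) ‖e‖²` over all rows. As more than `(1 - q - β) m` uncorrupted residuals are
  at least `Q`, this gives `Q² = O(‖e‖² / n)` (`quantile_residual_sq_le`).
* `∑ ⟨e, aᵢ⟩² ≥ κ (m / n) ‖e‖²` over every family of at least `3 q m / 4` rows, in particular over the
  admissible uncorrupted ones.

The contraction is `lintegral_stepKernel_le`. By the Markov property the mean square error decays
geometrically, and since it is summable the iterates converge almost surely
(`converges_of_bounds`).

For random rows both bounds hold up to exponentially small probability
(`pi_not_sum_inner_sq_le`, `pi_not_le_sum_inner_sq`). Two properties of a uniform point `θ` of the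
sphere enter: the exponential moment of `n ⟨e, θ⟩² / 4` is bounded, and `√n |⟨e, θ⟩|` is small only
with small probability, both uniformly in the dimension. They follow from the Gaussian case, because
a standard Gaussian vector is `θ` times an independent radius with mean square `n`
(`exists_radial_law`). The exponential Markov inequality (`pi_le_sum_le`) turns them into bounds for
a fixed `e`, whose failure probabilities are small enough to be summed over a net of the sphere of
size exponential in `n ≤ m`. For the upper bound a `1/2`-net is enough. For the lower bound the net
has a small fixed mesh `ε`; at each of its points at most `q m / 4` of the inner products are much
smaller than `1 / √n`, and by the upper bound, passing to a nearby unit vector spoils at most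
`q m / 4` further rows. The size `(1 + 2 / ε)ⁿ` of this net is what forces `m ≥ ρ n` with `ρ`
depending on `q`.
-/

namespace QuantileKaczmarz

/-! ### The law of the iterates -/

lemma map_eval_zero_iterates {m n : ℕ} (q : ℝ) (a : Fin m → EuclideanSpace ℝ (Fin n))
    (b : Fin m → ℝ) (x₀ : EuclideanSpace ℝ (Fin n)) :
    (iterates q a b x₀).map (fun ω => ω 0) = Measure.dirac x₀ := by
  have h : (fun ω : ℕ → EuclideanSpace ℝ (Fin n) => ω 0) =
      (fun h : (i : Finset.Iic 0) → EuclideanSpace ℝ (Fin n) => h ⟨0, by simp⟩) ∘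
        Preorder.frestrictLe (π := fun _ => EuclideanSpace ℝ (Fin n)) 0 := rfl
  rw [h, ← Measure.map_map (measurable_pi_apply _) (by fun_prop), iterates, Kernel.trajMeasure,
    Measure.map_comp _ _ (by fun_prop), Kernel.traj_map_frestrictLe, Kernel.partialTraj_self,
    Measure.id_comp, Measure.map_map (measurable_pi_apply _) (by fun_prop),
    Measure.map_dirac' (by fun_prop)]
  rfl

/-- The Markov property in integrated form. -/
lemma lintegral_iterates_succ {m n : ℕ} (q : ℝ) (a : Fin m → EuclideanSpace ℝ (Fin n))
    (b : Fin m → ℝ) (x₀ : EuclideanSpace ℝ (Fin n)) (k : ℕ)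
    {f : EuclideanSpace ℝ (Fin n) → ℝ≥0∞} (hf : Measurable f) :
    ∫⁻ ω, f (ω (k + 1)) ∂(iterates q a b x₀) =
      ∫⁻ ω, ∫⁻ z, f z ∂(stepKernel q a b (ω k)) ∂(iterates q a b x₀) := by
  have key := Kernel.map_frestrictLe_trajMeasure_compProd_eq_map_trajMeasure
    (X := fun _ => EuclideanSpace ℝ (Fin n)) (μ₀ := Measure.dirac x₀)
    (κ := fun k => (stepKernel q a b).comap
      (fun h : (i : Finset.Iic k) → EuclideanSpace ℝ (Fin n) => h ⟨k, Finset.mem_Iic.2 le_rfl⟩)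
      (measurable_pi_apply _)) (a := k)
  have key2 := congrArg (fun μ => ∫⁻ p, f p.2 ∂μ) key
  have hmeas : Measurable fun h : (i : Finset.Iic k) → EuclideanSpace ℝ (Fin n) =>
      ∫⁻ z, f z ∂(stepKernel q a b (h ⟨k, Finset.mem_Iic.2 le_rfl⟩)) :=
    (hf.lintegral_kernel (κ := stepKernel q a b)).comp
      (measurable_pi_apply (⟨k, Finset.mem_Iic.2 le_rfl⟩ : Finset.Iic k))
  rw [Measure.lintegral_compProd (by fun_prop)] at key2
  have h1 := lintegral_map (μ := iterates q a b x₀) hmeas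
    (Preorder.measurable_frestrictLe (X := fun _ => EuclideanSpace ℝ (Fin n)) k)
  have h2 := lintegral_map (μ := iterates q a b x₀) (hf.comp measurable_snd)
    ((Preorder.measurable_frestrictLe (X := fun _ => EuclideanSpace ℝ (Fin n)) k).prodMk
      (measurable_pi_apply (k + 1)))
  exact (h1.symm.trans (key2.trans h2)).symm

/-- A one-step contraction in mean square implies geometric decay of the mean square error. -/
lemma lintegral_iterates_le {m n : ℕ} {q : ℝ} {a : Fin m → EuclideanSpace ℝ (Fin n)}
    {b : Fin m → ℝ} {x : EuclideanSpace ℝ (Fin n)} {r : ℝ} (hr : 0 ≤ r)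
    (h : ∀ y, ∫⁻ z, ENNReal.ofReal (‖z - x‖ ^ 2) ∂(stepKernel q a b y) ≤
      ENNReal.ofReal (r * ‖y - x‖ ^ 2)) (x₀ : EuclideanSpace ℝ (Fin n)) (k : ℕ) :
    ∫⁻ ω, ENNReal.ofReal (‖ω k - x‖ ^ 2) ∂(iterates q a b x₀) ≤
      ENNReal.ofReal (r ^ k * ‖x₀ - x‖ ^ 2) := by
  induction k with
  | zero =>
    have h0 := lintegral_map (μ := iterates q a b x₀) (g := fun ω => ω 0)
      (f := fun z => ENNReal.ofReal (‖z - x‖ ^ 2)) (by fun_prop) (by fun_prop)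
    rw [map_eval_zero_iterates, lintegral_dirac' _ (by fun_prop)] at h0
    rw [pow_zero, one_mul, ← h0]
  | succ k ih =>
    rw [lintegral_iterates_succ q a b x₀ k (f := fun z => ENNReal.ofReal (‖z - x‖ ^ 2))
      (by fun_prop)]
    calc _ ≤ ∫⁻ ω, ENNReal.ofReal r * ENNReal.ofReal (‖ω k - x‖ ^ 2) ∂(iterates q a b x₀) := by
          refine lintegral_mono fun ω => (h (ω k)).trans_eq (ENNReal.ofReal_mul hr)
      _ = ENNReal.ofReal r * ∫⁻ ω, ENNReal.ofReal (‖ω k - x‖ ^ 2) ∂(iterates q a b x₀) :=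
          lintegral_const_mul _ (by fun_prop)
      _ ≤ ENNReal.ofReal r * ENNReal.ofReal (r ^ k * ‖x₀ - x‖ ^ 2) := by gcongr
      _ = _ := by rw [← ENNReal.ofReal_mul hr]; congr 1; ring

/-- A sequence of random points whose mean square distances to `x` are dominated by a geometric
series converges to `x` almost surely: the squared distances have a summable expectation. -/
lemma ae_tendsto_of_lintegral_le {E : Type*} [NormedAddCommGroup E] [MeasurableSpace E]
    [BorelSpace E] {μ : Measure (ℕ → E)} {x : E} {r C : ℝ} (hr : 0 ≤ r) (hr1 : r < 1)
    (h : ∀ k : ℕ, ∫⁻ ω, ENNReal.ofReal (‖ω k - x‖ ^ 2) ∂μ ≤ ENNReal.ofReal (r ^ k * C)) :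
    ∀ᵐ ω ∂μ, Tendsto ω atTop (𝓝 x) := by
  have hm : ∀ k : ℕ, Measurable fun ω : ℕ → E => ENNReal.ofReal (‖ω k - x‖ ^ 2) := by
    intro k
    have : Continuous fun z : E => ENNReal.ofReal (‖z - x‖ ^ 2) :=
      ENNReal.continuous_ofReal.comp (by fun_prop)
    exact this.measurable.comp (measurable_pi_apply k)
  have hsum : ∫⁻ ω, ∑' k, ENNReal.ofReal (‖ω k - x‖ ^ 2) ∂μ ≠ ∞ := by
    rw [lintegral_tsum fun k => (hm k).aemeasurable]
    refine ne_top_of_le_ne_top ?_ (ENNReal.tsum_le_tsum h)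
    exact ((summable_geometric_of_lt_one hr hr1).mul_right C).tsum_ofReal_ne_top
  filter_upwards [ae_lt_top (Measurable.tsum hm) hsum] with ω hω
  have h1 := ENNReal.tendsto_atTop_zero_of_tsum_ne_top hω.ne
  have h2 := (ENNReal.tendsto_toReal ENNReal.zero_ne_top).comp h1
  have h3 : Tendsto (fun k => ‖ω k - x‖ ^ 2) atTop (𝓝 0) := by
    refine h2.congr fun k => ?_
    simp
  rw [tendsto_iff_norm_sub_tendsto_zero]
  simpa using h3.sqrt

/-! ### Quantiles -/

/-- The quantile is attained: at least `q m` of the numbers are at most their `q`-quantile, and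
fewer than `q m` of them are strictly below it. -/
lemma quantile_spec {m : ℕ} {q : ℝ} (hq0 : 0 < q) (hq1 : q < 1) (hm : 0 < m) (y : Fin m → ℝ) :
    q * m ≤ ((Finset.univ.filter fun i => y i ≤ quantile q y).card : ℝ) ∧
      ((Finset.univ.filter fun i => y i < quantile q y).card : ℝ) < q * m := by
  have hmR : (0 : ℝ) < m := by exact_mod_cast hm
  set S := {t : ℝ | q * m ≤ ((Finset.univ.filter fun i => y i ≤ t).card : ℝ)} with hS
  have hbdd : BddBelow S := by
    refine ⟨-∑ i, |y i|, fun t ht => ?_⟩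
    have hpos : 0 < ((Finset.univ.filter fun i => y i ≤ t).card : ℝ) :=
      (mul_pos hq0 hmR).trans_le ht
    obtain ⟨i, hi⟩ := Finset.card_pos.1 (by exact_mod_cast hpos)
    have h2 : y i ≤ t := (Finset.mem_filter.1 hi).2
    have h3 : |y i| ≤ ∑ i, |y i| :=
      Finset.single_le_sum (f := fun i => |y i|) (fun j _ => abs_nonneg _) (Finset.mem_univ i)
    have := neg_abs_le (y i)
    linarith
  have hne : S.Nonempty := by
    refine ⟨∑ i, |y i|, ?_⟩
    have : (Finset.univ.filter fun i => y i ≤ ∑ i, |y i|) = Finset.univ := by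
      refine Finset.filter_true_of_mem fun i _ => (le_abs_self _).trans ?_
      exact Finset.single_le_sum (f := fun i => |y i|) (fun j _ => abs_nonneg _)
        (Finset.mem_univ i)
    rw [hS, Set.mem_ofPred_eq, this]
    simp only [Finset.card_univ, Fintype.card_fin]
    nlinarith
  -- The largest value in a set `F` of at least `q m` indices is a threshold in `S`, so it cannot be
  -- below the infimum.
  have hlt : ∀ F : Finset (Fin m), (∀ i ∈ F, y i < quantile q y) → (F.card : ℝ) < q * m := by
    intro F hF
    by_contra! hcon
    have hFne : F.Nonempty := by
      rw [← Finset.card_pos]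
      exact_mod_cast (mul_pos hq0 hmR).trans_le hcon
    obtain ⟨i, hi, hmax⟩ := F.exists_max_image y hFne
    have hmem : y i ∈ S := by
      refine hcon.trans ?_
      exact_mod_cast Finset.card_le_card fun j hj => by simpa using hmax j hj
    exact absurd (csInf_le hbdd hmem) (not_le.2 (hF i hi))
  refine ⟨?_, hlt _ fun i hi => (Finset.mem_filter.1 hi).2⟩
  by_contra! hcon
  -- Being finitely many, the values above the quantile are bounded away from it, by some `s`; so a
  -- threshold in `S` below `s` counts no more values than the quantile itself.
  set G := Finset.univ.filter fun i => quantile q y < y i with hG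
  obtain ⟨s, hs, hsG⟩ : ∃ s, quantile q y < s ∧ ∀ i ∈ G, s ≤ y i := by
    by_cases hGe : G.Nonempty
    · obtain ⟨i, hi, hmin⟩ := G.exists_min_image y hGe
      exact ⟨y i, (Finset.mem_filter.1 hi).2, hmin⟩
    · exact ⟨quantile q y + 1, by linarith, fun i hi => absurd ⟨i, hi⟩ hGe⟩
  obtain ⟨t, ht, hts⟩ := exists_lt_of_csInf_lt hne (show sInf S < s from hs)
  have : ((Finset.univ.filter fun i => y i ≤ t).card : ℝ) ≤
      ((Finset.univ.filter fun i => y i ≤ quantile q y).card : ℝ) := by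
    refine mod_cast Finset.card_le_card fun i hi => ?_
    simp only [Finset.mem_filter, Finset.mem_univ, true_and] at hi ⊢
    by_contra! hi2
    have := hsG i (by simpa [hG] using hi2)
    linarith
  have ht' : q * m ≤ ((Finset.univ.filter fun i => y i ≤ t).card : ℝ) := ht
  linarith

/-! ### Contraction of the mean square error -/

lemma norm_kaczmarzStep_sub_sq {m n : ℕ} {a : Fin m → EuclideanSpace ℝ (Fin n)} {b : Fin m → ℝ}
    (ha : ∀ i, ‖a i‖ = 1) (x y : EuclideanSpace ℝ (Fin n)) (i : Fin m) :
    ‖kaczmarzStep a b y i - x‖ ^ 2 =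
      ‖y - x‖ ^ 2 + 2 * ((b i - inner ℝ y (a i)) * inner ℝ (y - x) (a i)) +
        (b i - inner ℝ y (a i)) ^ 2 := by
  have h : kaczmarzStep a b y i - x = (y - x) + (b i - inner ℝ y (a i)) • a i := by
    rw [kaczmarzStep, real_inner_comm]; abel
  rw [h, norm_add_sq_real, inner_smul_right, norm_smul, ha i, mul_one, Real.norm_eq_abs, sq_abs]

lemma lintegral_stepKernel {m n : ℕ} {q : ℝ} {a : Fin m → EuclideanSpace ℝ (Fin n)}
    {b : Fin m → ℝ} {y : EuclideanSpace ℝ (Fin n)} (hne : (admissible q a b y).Nonempty)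
    {f : EuclideanSpace ℝ (Fin n) → ℝ} (hf : Measurable f) (hf0 : ∀ z, 0 ≤ f z) :
    ∫⁻ z, ENNReal.ofReal (f z) ∂(stepKernel q a b y) =
      ENNReal.ofReal (((admissible q a b y).card : ℝ)⁻¹ *
        ∑ i ∈ admissible q a b y, f (kaczmarzStep a b y i)) := by
  change ∫⁻ z, ENNReal.ofReal (f z) ∂(uniformStep a b (admissible q a b y) y) = _
  have hc : (0 : ℝ) < (admissible q a b y).card := by exact_mod_cast hne.card_pos
  rw [uniformStep, if_neg hne.ne_empty, lintegral_smul_measure, lintegral_finsetSum_measure,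
    ENNReal.ofReal_mul (by positivity), ENNReal.ofReal_inv_of_pos hc, ENNReal.ofReal_natCast,
    ENNReal.ofReal_sum_of_nonneg fun i _ => hf0 _]
  simp only [smul_eq_mul]
  congr 1
  exact Finset.sum_congr rfl fun i _ => lintegral_dirac' _ (by fun_prop)

/-- The square of the quantile is at most a multiple of the mean squared residual of the
uncorrupted system: more than `(1 - q - β) m` uncorrupted residuals are at least the quantile. -/
lemma quantile_residual_sq_le {m n : ℕ} {q β M : ℝ} (hq0 : 0 < q) (hq1 : q < 1) (hm : 0 < m)
    {a : Fin m → EuclideanSpace ℝ (Fin n)} {b : Fin m → ℝ} {x y : EuclideanSpace ℝ (Fin n)}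
    (hβ : β ≤ (1 - q) / 2)
    (hb : ((Finset.univ.filter fun i => b i ≠ inner ℝ (a i) x).card : ℝ) ≤ β * m)
    (hM : ∑ i, inner ℝ (y - x) (a i) ^ 2 ≤ M * m) :
    quantile q (residual a b y) ^ 2 * (1 - q) ≤ 2 * M := by
  have hmR : (0 : ℝ) < m := by exact_mod_cast hm
  set Q := quantile q (residual a b y) with hQ
  obtain ⟨h1, h2⟩ := quantile_spec hq0 hq1 hm (residual a b y)
  have hQ0 : 0 ≤ Q := by
    have hpos : 0 < ((Finset.univ.filter fun i => residual a b y i ≤ Q).card : ℝ) :=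
      (mul_pos hq0 hmR).trans_le h1
    obtain ⟨i, hi⟩ := Finset.card_pos.1 (by exact_mod_cast hpos)
    exact (abs_nonneg _).trans (Finset.mem_filter.1 hi).2
  set F := Finset.univ.filter fun i => ¬ residual a b y i < Q with hF
  set D := Finset.univ.filter fun i => b i ≠ inner ℝ (a i) x with hD
  have hFcard : (1 - q) * m ≤ F.card := by
    have := Finset.card_filter_add_card_filter_not (s := (Finset.univ : Finset (Fin m)))
      (fun i => residual a b y i < Q)
    rw [Finset.card_univ, Fintype.card_fin] at this
    have h3 : ((Finset.univ.filter fun i => residual a b y i < Q).card : ℝ) + F.card = m := by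
      exact_mod_cast this
    linarith
  have hFD : (1 - q) / 2 * m ≤ ((F \ D).card : ℝ) := by
    have : (F.card : ℝ) ≤ (F \ D).card + D.card := by
      have := Finset.le_card_sdiff D F
      have : F.card ≤ (F \ D).card + D.card := by omega
      exact_mod_cast this
    nlinarith
  have h3 : ((F \ D).card : ℝ) * Q ^ 2 ≤ ∑ i, inner ℝ (y - x) (a i) ^ 2 := by
    calc ((F \ D).card : ℝ) * Q ^ 2 = ∑ i ∈ F \ D, Q ^ 2 := by simp
      _ ≤ ∑ i ∈ F \ D, inner ℝ (y - x) (a i) ^ 2 := by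
          refine Finset.sum_le_sum fun i hi => ?_
          simp only [hF, hD, Finset.mem_sdiff, Finset.mem_filter, Finset.mem_univ, true_and,
            not_lt, not_not] at hi
          have hr : residual a b y i = |inner ℝ (y - x) (a i)| := by
            rw [residual, hi.2, inner_sub_left, real_inner_comm x]
          rw [← sq_abs (inner ℝ (y - x) (a i)), ← hr]
          exact pow_le_pow_left₀ hQ0 hi.1 2
      _ ≤ _ := Finset.sum_le_sum_of_subset_of_nonneg (Finset.subset_univ _)
          fun i _ _ => sq_nonneg _
  have h4 : (1 - q) / 2 * m * Q ^ 2 ≤ M * m := by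
    nlinarith [mul_le_mul_of_nonneg_right hFD (sq_nonneg Q)]
  have h5 : (Q ^ 2 * (1 - q)) * m ≤ (2 * M) * m := by linarith
  exact le_of_mul_le_mul_right h5 hmR

/-- Mean square contraction in one step. The admissible uncorrupted equations decrease the squared
error by `⟨y - x, aᵢ⟩²` each, which the lower bound on submatrices makes large in total. A corrupted
admissible equation moves the point by at most the quantile `Q`, which increases the squared error
by at most `2 Q |⟨y - x, aᵢ⟩| + Q²`; the inequality between the means with weight `τ = κ / (4 M)`
and the smallness of `δ` keep the total increase below half the decrease. -/
lemma lintegral_stepKernel_le {m n : ℕ} {q δ M κ : ℝ} (hq0 : 0 < q) (hq1 : q < 1)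
    (hm : 0 < m) (hn : 0 < n) (hM : 0 < M) (hκ : 0 < κ) (hδ0 : 0 ≤ δ) (hδq : δ ≤ q / 4)
    (hδ1 : δ ≤ (1 - q) / 2) (hδM : δ * (1 + 4 * M / κ) * (2 * M) ≤ κ / 4 * (1 - q))
    {a : Fin m → EuclideanSpace ℝ (Fin n)} (ha : ∀ i, ‖a i‖ = 1)
    (hup : ∀ e, ∑ i, inner ℝ e (a i) ^ 2 ≤ M * (m / n) * ‖e‖ ^ 2)
    (hlow : ∀ T : Finset (Fin m), 3 / 4 * q * m ≤ T.card → ∀ e,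
      κ * (m / n) * ‖e‖ ^ 2 ≤ ∑ i ∈ T, inner ℝ e (a i) ^ 2)
    {b : Fin m → ℝ} {x : EuclideanSpace ℝ (Fin n)}
    (hb : ((Finset.univ.filter fun i => b i ≠ inner ℝ (a i) x).card : ℝ) ≤ δ * m)
    (y : EuclideanSpace ℝ (Fin n)) :
    ∫⁻ z, ENNReal.ofReal (‖z - x‖ ^ 2) ∂(stepKernel q a b y) ≤
      ENNReal.ofReal ((1 - min 1 (κ / (2 * n))) * ‖y - x‖ ^ 2) := by
  have hmR : (0 : ℝ) < m := by exact_mod_cast hm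
  have hnR : (0 : ℝ) < n := by exact_mod_cast hn
  set e := y - x with he
  set Q := quantile q (residual a b y) with hQ
  set B := admissible q a b y with hB
  set D := Finset.univ.filter fun i => b i ≠ inner ℝ (a i) x with hD
  have hBcard : q * m ≤ B.card := (quantile_spec hq0 hq1 hm (residual a b y)).1
  have hBne : B.Nonempty := by
    rw [← Finset.card_pos]
    exact_mod_cast (mul_pos hq0 hmR).trans_le hBcard
  have hQ2 : Q ^ 2 * (1 - q) ≤ 2 * (M / n * ‖e‖ ^ 2) := by
    refine quantile_residual_sq_le hq0 hq1 hm hδ1 hb ((hup e).trans_eq ?_)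
    field_simp
  have hgood : κ * (m / n) * ‖e‖ ^ 2 ≤ ∑ i ∈ B \ D, inner ℝ e (a i) ^ 2 := by
    refine hlow _ ?_ e
    have : (B.card : ℝ) ≤ (B \ D).card + D.card := by
      have := Finset.le_card_sdiff D B
      have : B.card ≤ (B \ D).card + D.card := by omega
      exact_mod_cast this
    nlinarith
  set τ := κ / (4 * M) with hτ
  have hτ0 : 0 < τ := by positivity
  have hbad : ∀ i ∈ B ∩ D, ‖kaczmarzStep a b y i - x‖ ^ 2 ≤
      ‖e‖ ^ 2 + τ * inner ℝ e (a i) ^ 2 + Q ^ 2 * (1 + 1 / τ) := by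
    intro i hi
    rw [norm_kaczmarzStep_sub_sq ha]
    set s := b i - inner ℝ y (a i) with hs
    have hsQ : s ^ 2 ≤ Q ^ 2 := by
      have : residual a b y i ≤ Q := (Finset.mem_filter.1 (Finset.mem_inter.1 hi).1).2
      rw [residual, abs_sub_comm] at this
      exact sq_le_sq' (by linarith [neg_abs_le s]) ((le_abs_self s).trans this)
    have hamgm : 2 * (s * inner ℝ e (a i)) ≤ τ * inner ℝ e (a i) ^ 2 + s ^ 2 / τ := by
      have : 0 ≤ (τ * inner ℝ e (a i) - s) ^ 2 / τ := by positivity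
      have h2 : (τ * inner ℝ e (a i) - s) ^ 2 / τ =
          τ * inner ℝ e (a i) ^ 2 + s ^ 2 / τ - 2 * (s * inner ℝ e (a i)) := by
        field_simp
        ring
      linarith
    have : s ^ 2 / τ ≤ Q ^ 2 / τ := by gcongr
    have h3 : Q ^ 2 * (1 + 1 / τ) = Q ^ 2 + Q ^ 2 / τ := by ring
    linarith
  have hgood' : ∀ i ∈ B \ D, ‖kaczmarzStep a b y i - x‖ ^ 2 =
      ‖e‖ ^ 2 - inner ℝ e (a i) ^ 2 := by
    intro i hi
    rw [norm_kaczmarzStep_sub_sq ha]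
    have hbi : b i = inner ℝ x (a i) := by
      rw [real_inner_comm]
      simpa [hD] using (Finset.mem_sdiff.1 hi).2
    have : b i - inner ℝ y (a i) = -inner ℝ e (a i) := by
      rw [he, inner_sub_left, hbi]; ring
    rw [this]; ring
  have hsum : ∑ i ∈ B, ‖kaczmarzStep a b y i - x‖ ^ 2 ≤
      B.card * ‖e‖ ^ 2 - κ / 2 * (m / n) * ‖e‖ ^ 2 := by
    have hcard : (B.card : ℝ) = (B ∩ D).card + (B \ D).card := by
      exact_mod_cast (Finset.card_inter_add_card_sdiff B D).symm
    have hDle : ((B ∩ D).card : ℝ) ≤ δ * m :=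
      (Nat.cast_le.2 (Finset.card_le_card Finset.inter_subset_right)).trans hb
    have h1 : ∑ i ∈ B ∩ D, ‖kaczmarzStep a b y i - x‖ ^ 2 ≤
        (B ∩ D).card * ‖e‖ ^ 2 + κ / 4 * (m / n) * ‖e‖ ^ 2 + κ / 4 * (m / n) * ‖e‖ ^ 2 := by
      refine (Finset.sum_le_sum hbad).trans ?_
      rw [Finset.sum_add_distrib, Finset.sum_add_distrib, ← Finset.mul_sum, Finset.sum_const,
        Finset.sum_const, nsmul_eq_mul, nsmul_eq_mul]
      have h2 : ∑ i ∈ B ∩ D, inner ℝ e (a i) ^ 2 ≤ M * (m / n) * ‖e‖ ^ 2 :=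
        (Finset.sum_le_sum_of_subset_of_nonneg (Finset.subset_univ _)
          fun i _ _ => sq_nonneg _).trans (hup e)
      have h3 : τ * ∑ i ∈ B ∩ D, inner ℝ e (a i) ^ 2 ≤ κ / 4 * (m / n) * ‖e‖ ^ 2 := by
        refine (mul_le_mul_of_nonneg_left h2 hτ0.le).trans_eq ?_
        rw [hτ]
        field_simp
      have h4 : ((B ∩ D).card : ℝ) * (Q ^ 2 * (1 + 1 / τ)) ≤ κ / 4 * (m / n) * ‖e‖ ^ 2 := by
        have h5 : ((B ∩ D).card : ℝ) * (Q ^ 2 * (1 + 1 / τ)) ≤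
            δ * m * (Q ^ 2 * (1 + 1 / τ)) :=
          mul_le_mul_of_nonneg_right hDle (by positivity)
        have h1τ : 1 / τ = 4 * M / κ := by rw [hτ]; field_simp
        rw [h1τ] at h5 ⊢
        refine h5.trans ?_
        have hq : 0 < 1 - q := by linarith
        refine le_of_mul_le_mul_right ?_ hq
        calc δ * m * (Q ^ 2 * (1 + 4 * M / κ)) * (1 - q)
            = δ * (1 + 4 * M / κ) * m * (Q ^ 2 * (1 - q)) := by ring
          _ ≤ δ * (1 + 4 * M / κ) * m * (2 * (M / n * ‖e‖ ^ 2)) := by gcongr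
          _ = (δ * (1 + 4 * M / κ) * (2 * M)) * (m / n * ‖e‖ ^ 2) := by ring
          _ ≤ (κ / 4 * (1 - q)) * (m / n * ‖e‖ ^ 2) := by gcongr
          _ = _ := by ring
      linarith
    have h2 : ∑ i ∈ B \ D, ‖kaczmarzStep a b y i - x‖ ^ 2 ≤
        (B \ D).card * ‖e‖ ^ 2 - κ * (m / n) * ‖e‖ ^ 2 := by
      rw [Finset.sum_congr rfl hgood', Finset.sum_sub_distrib, Finset.sum_const, nsmul_eq_mul]
      linarith
    rw [← Finset.sum_inter_add_sum_sdiff B D, hcard]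
    linarith
  rw [lintegral_stepKernel hBne (f := fun z => ‖z - x‖ ^ 2) (by fun_prop) fun z => sq_nonneg _]
  refine ENNReal.ofReal_le_ofReal ?_
  have hBpos : (0 : ℝ) < B.card := by exact_mod_cast hBne.card_pos
  have hBm : (B.card : ℝ) ≤ m := by
    have := Finset.card_le_univ B
    rw [Fintype.card_fin] at this
    exact_mod_cast this
  rw [inv_mul_le_iff₀ hBpos]
  refine hsum.trans ?_
  have hmin : min 1 (κ / (2 * n)) ≤ κ / (2 * n) := min_le_right _ _
  have h1 : (B.card : ℝ) * min 1 (κ / (2 * n)) ≤ κ / 2 * (m / n) :=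
    calc (B.card : ℝ) * min 1 (κ / (2 * n)) ≤ m * (κ / (2 * n)) := by gcongr
      _ = _ := by ring
  nlinarith [mul_le_mul_of_nonneg_right h1 (sq_nonneg ‖e‖)]

/-- Convergence for every matrix with unit rows whose quadratic form has the right order of
magnitude from above and, restricted to any `3 q m / 4` rows, from below. -/
lemma converges_of_bounds {m n : ℕ} {q δ M κ : ℝ} (hq0 : 0 < q) (hq1 : q < 1)
    (hm : 0 < m) (hn : 0 < n) (hM : 0 < M) (hκ : 0 < κ) (hδ0 : 0 ≤ δ) (hδq : δ ≤ q / 4)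
    (hδ1 : δ ≤ (1 - q) / 2) (hδM : δ * (1 + 4 * M / κ) * (2 * M) ≤ κ / 4 * (1 - q))
    {a : Fin m → EuclideanSpace ℝ (Fin n)} (ha : ∀ i, ‖a i‖ = 1)
    (hup : ∀ e, ∑ i, inner ℝ e (a i) ^ 2 ≤ M * (m / n) * ‖e‖ ^ 2)
    (hlow : ∀ T : Finset (Fin m), 3 / 4 * q * m ≤ T.card → ∀ e,
      κ * (m / n) * ‖e‖ ^ 2 ≤ ∑ i ∈ T, inner ℝ e (a i) ^ 2) {β : ℝ} (hβ : β ≤ δ) :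
    Converges q β a := by
  have hmR : (0 : ℝ) < m := by exact_mod_cast hm
  have hnR : (0 : ℝ) < n := by exact_mod_cast hn
  have hc0 : 0 < min 1 (κ / (2 * n)) := lt_min one_pos (by positivity)
  refine ⟨min 1 (κ / (2 * n)), hc0, min_le_left _ _, fun x bt b x₀ hbt hb => ?_⟩
  obtain rfl : bt = fun i => inner ℝ (a i) x := funext fun i => (hbt i).symm
  have hdecay := lintegral_iterates_le (sub_nonneg.2 (min_le_left 1 (κ / (2 * n))))
    (lintegral_stepKernel_le hq0 hq1 hm hn hM hκ hδ0 hδq hδ1 hδM ha hup hlow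
      (hb.trans (by gcongr))) x₀
  exact ⟨hdecay, ae_tendsto_of_lintegral_le (sub_nonneg.2 (min_le_left _ _)) (by linarith) hdecay⟩

/-! ### Exponential Markov inequality and nets of the sphere -/

lemma lintegral_pi_prod {ι : Type*} [Fintype ι] {Ω : ι → Type*} [∀ i, MeasurableSpace (Ω i)]
    (μ : ∀ i, Measure (Ω i)) [∀ i, IsProbabilityMeasure (μ i)] {f : ∀ i, Ω i → ℝ≥0∞}
    (hf : ∀ i, Measurable (f i)) :
    ∫⁻ x, ∏ i, f i (x i) ∂(Measure.pi μ) = ∏ i, ∫⁻ x, f i x ∂(μ i) := by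
  rw [lintegral_prod_eq_prod_lintegral_of_indepFun (μ := Measure.pi μ) Finset.univ
    (fun i (x : ∀ i, Ω i) => f i (x i))
    (iIndepFun_pi fun i => (hf i).aemeasurable) fun i => (hf i).comp (measurable_pi_apply i)]
  refine Finset.prod_congr rfl fun i _ => ?_
  exact (measurePreserving_eval μ i).lintegral_comp (hf i)

/-- The exponential Markov inequality for a sum of independent copies of `f`. -/
lemma pi_le_sum_le {Ω : Type*} [MeasurableSpace Ω] {μ : Measure Ω} [IsProbabilityMeasure μ]
    {f : Ω → ℝ} (hf : Measurable f) {K : ℝ} (hK0 : 0 ≤ K)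
    (hK : ∫⁻ x, ENNReal.ofReal (Real.exp (f x)) ∂μ ≤ ENNReal.ofReal K) (t : ℝ) (m : ℕ) :
    Measure.pi (fun _ : Fin m => μ) {a | t * m ≤ ∑ i, f (a i)} ≤
      ENNReal.ofReal ((Real.exp (-t) * K) ^ m) := by
  have hg : Measurable fun x => ENNReal.ofReal (Real.exp (f x - t)) := by fun_prop
  have hint : ∫⁻ x, ENNReal.ofReal (Real.exp (f x - t)) ∂μ ≤
      ENNReal.ofReal (Real.exp (-t) * K) := by
    simp_rw [sub_eq_neg_add, Real.exp_add, ENNReal.ofReal_mul (Real.exp_pos _).le]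
    rw [lintegral_const_mul _ (by fun_prop)]
    gcongr
  calc Measure.pi (fun _ : Fin m => μ) {a | t * m ≤ ∑ i, f (a i)}
      ≤ Measure.pi (fun _ : Fin m => μ)
          {a | 1 ≤ ∏ i, ENNReal.ofReal (Real.exp (f (a i) - t))} := by
        refine measure_mono fun a ha => ?_
        rw [Set.mem_ofPred_eq] at ha ⊢
        rw [← ENNReal.ofReal_prod_of_nonneg fun i _ => (Real.exp_pos _).le, ← Real.exp_sum,
          ENNReal.one_le_ofReal, Real.one_le_exp_iff, Finset.sum_sub_distrib]
        simp only [Finset.sum_const, Finset.card_univ, Fintype.card_fin, nsmul_eq_mul]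
        linarith
    _ ≤ ∫⁻ a, ∏ i, ENNReal.ofReal (Real.exp (f (a i) - t)) ∂(Measure.pi fun _ : Fin m => μ) := by
        have := mul_meas_ge_le_lintegral (μ := Measure.pi fun _ : Fin m => μ)
          (f := fun a => ∏ i, ENNReal.ofReal (Real.exp (f (a i) - t)))
          (Finset.measurable_prod _ fun i _ => hg.comp (measurable_pi_apply i)) 1
        simpa using this
    _ = (∫⁻ x, ENNReal.ofReal (Real.exp (f x - t)) ∂μ) ^ m := by
        rw [lintegral_pi_prod (fun _ : Fin m => μ) fun _ => hg]
        simp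
    _ ≤ ENNReal.ofReal (Real.exp (-t) * K) ^ m := by gcongr
    _ = _ := (ENNReal.ofReal_pow (by positivity) m).symm

/-- Volume bound for separated sets: the balls of radius `ε / 2` about the points are disjoint
and lie in the ball of radius `1 + ε / 2`. -/
lemma card_le_of_separated_unit {E : Type*} [NormedAddCommGroup E] [NormedSpace ℝ E]
    [FiniteDimensional ℝ E] {ε : ℝ} (hε : 0 < ε) (s : Finset E) (hs : ∀ c ∈ s, ‖c‖ = 1)
    (h : ∀ c ∈ s, ∀ d ∈ s, c ≠ d → ε ≤ ‖c - d‖) :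
    (s.card : ℝ) ≤ (1 + 2 / ε) ^ Module.finrank ℝ E := by
  borelize E
  let μ : Measure E := Measure.addHaar
  have hD : Set.Pairwise (s : Set E) (Function.onFun Disjoint fun c => Metric.ball c (ε / 2)) := by
    intro c hc d hd hcd
    refine Metric.ball_disjoint_ball ?_
    rw [dist_eq_norm]
    linarith [h c hc d hd hcd]
  have hsub : ⋃ c ∈ s, Metric.ball c (ε / 2) ⊆ Metric.ball 0 (1 + ε / 2) := by
    refine Set.iUnion₂_subset fun c hc => Metric.ball_subset_ball' ?_
    rw [dist_zero_right, hs c hc]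
    linarith
  have hI : (s.card : ℝ≥0∞) * ENNReal.ofReal ((ε / 2) ^ Module.finrank ℝ E) *
      μ (Metric.ball 0 1) ≤
        ENNReal.ofReal ((1 + ε / 2) ^ Module.finrank ℝ E) * μ (Metric.ball 0 1) :=
    calc _ = μ (⋃ c ∈ s, Metric.ball c (ε / 2)) := by
          rw [measure_biUnion_finset hD fun c _ => measurableSet_ball]
          simp only [μ.addHaar_ball_of_pos _ (half_pos hε)]
          simp only [Finset.sum_const, nsmul_eq_mul, mul_assoc]
      _ ≤ μ (Metric.ball 0 (1 + ε / 2)) := measure_mono hsub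
      _ = _ := by rw [μ.addHaar_ball_of_pos _ (by positivity)]
  have hJ := (ENNReal.mul_le_mul_iff_left (Metric.measure_ball_pos μ _ zero_lt_one).ne'
    measure_ball_lt_top.ne).1 hI
  have hK := ENNReal.toReal_le_of_le_ofReal (by positivity) hJ
  rw [ENNReal.toReal_mul, ENNReal.toReal_natCast, ENNReal.toReal_ofReal (by positivity),
    ← le_div_iff₀ (by positivity), ← div_pow] at hK
  rwa [show 1 + 2 / ε = (1 + ε / 2) / (ε / 2) by field_simp; ring]

/-- The unit sphere of a finite-dimensional space has an `ε`-net of size exponential in the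
dimension. -/
lemma exists_net {E : Type*} [NormedAddCommGroup E] [NormedSpace ℝ E] [FiniteDimensional ℝ E]
    {ε : ℝ} (hε : 0 < ε) :
    ∃ s : Finset E, (∀ c ∈ s, ‖c‖ = 1) ∧ (s.card : ℝ) ≤ (1 + 2 / ε) ^ Module.finrank ℝ E ∧
      ∀ e : E, ‖e‖ = 1 → ∃ c ∈ s, ‖e - c‖ ≤ ε := by
  classical
  -- A separated set of maximal cardinality is a net.
  let P : ℕ → Prop := fun k => ∃ s : Finset E, (∀ c ∈ s, ‖c‖ = 1) ∧
    (∀ c ∈ s, ∀ d ∈ s, c ≠ d → ε ≤ ‖c - d‖) ∧ s.card = k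
  have hP0 : P 0 := ⟨∅, by simp, by simp, rfl⟩
  have hPb : ∀ k, P k → k ≤ ⌊(1 + 2 / ε) ^ Module.finrank ℝ E⌋₊ := by
    rintro _ ⟨s, h1, h2, rfl⟩
    exact Nat.le_floor (card_le_of_separated_unit hε s h1 h2)
  obtain ⟨s, h1, h2, h3⟩ := Nat.findGreatest_spec (P := P) (Nat.zero_le _) hP0
  refine ⟨s, h1, card_le_of_separated_unit hε s h1 h2, fun e he => ?_⟩
  by_contra! hcon
  have hes : e ∉ s := fun hes => by
    have := hcon e hes
    rw [sub_self, norm_zero] at this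
    linarith
  have hP : P (insert e s).card := by
    refine ⟨insert e s, ?_, ?_, rfl⟩
    · simpa [he] using h1
    · intro c hc d hd hcd
      rcases Finset.mem_insert.1 hc with rfl | hc' <;> rcases Finset.mem_insert.1 hd with rfl | hd'
      · exact absurd rfl hcd
      · exact (hcon d hd').le
      · rw [norm_sub_rev]; exact (hcon c hc').le
      · exact h2 c hc' d hd' hcd
  have := Nat.le_findGreatest (hPb _ hP) hP
  rw [← h3, Finset.card_insert_of_notMem hes] at this
  omega

/-- A bound for the quadratic form on a `1/2`-net of the unit sphere extends to all vectors. -/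
lemma sum_inner_sq_le_of_net {ι E : Type*} [Fintype ι] [NormedAddCommGroup E]
    [InnerProductSpace ℝ E] [FiniteDimensional ℝ E] {a : ι → E} {s : Finset E} {L : ℝ}
    (hnet : ∀ e : E, ‖e‖ = 1 → ∃ c ∈ s, ‖e - c‖ ≤ 1 / 2)
    (hs : ∀ c ∈ s, ∑ i, inner ℝ c (a i) ^ 2 ≤ L) (hL : 0 ≤ L) (e : E) :
    ∑ i, inner ℝ e (a i) ^ 2 ≤ 4 * L * ‖e‖ ^ 2 := by
  let T : E →L[ℝ] EuclideanSpace ℝ ι := LinearMap.toContinuousLinearMap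
    ((WithLp.linearEquiv 2 ℝ (ι → ℝ)).symm.toLinearMap ∘ₗ
      LinearMap.pi fun i => (innerₗ E (a i)))
  have hT : ∀ e, ‖T e‖ ^ 2 = ∑ i, inner ℝ e (a i) ^ 2 := by
    intro e
    rw [EuclideanSpace.real_norm_sq_eq]
    refine Finset.sum_congr rfl fun i _ => ?_
    rw [real_inner_comm]
    rfl
  have hbound : ‖T‖ ≤ √L + ‖T‖ * (1 / 2) := by
    refine ContinuousLinearMap.opNorm_le_of_unit_norm (by positivity) fun e he => ?_
    obtain ⟨c, hc, hec⟩ := hnet e he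
    have h1 : ‖T c‖ ≤ √L := Real.le_sqrt_of_sq_le (by rw [hT]; exact hs c hc)
    calc ‖T e‖ = ‖T c + T (e - c)‖ := by rw [← map_add, add_sub_cancel]
      _ ≤ ‖T c‖ + ‖T (e - c)‖ := norm_add_le _ _
      _ ≤ √L + ‖T‖ * (1 / 2) := by
          gcongr
          exact (T.le_opNorm _).trans (by gcongr)
  have hT2 : ‖T‖ ≤ 2 * √L := by linarith
  calc ∑ i, inner ℝ e (a i) ^ 2 = ‖T e‖ ^ 2 := (hT e).symm
    _ ≤ (2 * √L * ‖e‖) ^ 2 := by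
        gcongr
        exact (T.le_opNorm _).trans (by gcongr)
    _ = 4 * L * ‖e‖ ^ 2 := by rw [mul_pow, mul_pow, Real.sq_sqrt hL]; ring

/-- If at every point of a fine net only few of the linear forms `⟨·, aᵢ⟩` are small, then at
every unit vector only slightly more of them are small, so that the quadratic form restricted to
any large set of indices is bounded below. -/
lemma le_sum_inner_sq_of_net {ι E : Type*} [Fintype ι] [NormedAddCommGroup E]
    [InnerProductSpace ℝ E] {a : ι → E} {s : Finset E} {U ε η k : ℝ} (hη : 0 < η)
    (hU0 : 0 ≤ U)
    (hnet : ∀ e : E, ‖e‖ = 1 → ∃ c ∈ s, ‖e - c‖ ≤ ε)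
    (hU : ∀ e : E, ∑ i, inner ℝ e (a i) ^ 2 ≤ U * ‖e‖ ^ 2) (hUk : U * ε ^ 2 ≤ k * (η / 2) ^ 2)
    (hs : ∀ c ∈ s, ((Finset.univ.filter fun i => |inner ℝ c (a i)| ≤ η).card : ℝ) ≤ k)
    {T : Finset ι} (hT : 3 * k ≤ T.card) (e : E) :
    k * (η / 2) ^ 2 * ‖e‖ ^ 2 ≤ ∑ i ∈ T, inner ℝ e (a i) ^ 2 := by
  classical
  have hunit : ∀ e : E, ‖e‖ = 1 → k * (η / 2) ^ 2 ≤ ∑ i ∈ T, inner ℝ e (a i) ^ 2 := by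
    intro e he
    obtain ⟨c, hc, hec⟩ := hnet e he
    set F := Finset.univ.filter fun i => |inner ℝ c (a i)| ≤ η with hF
    set G := Finset.univ.filter fun i => η / 2 ≤ |inner ℝ (e - c) (a i)| with hG
    have hGcard : (G.card : ℝ) ≤ k := by
      have h1 : (G.card : ℝ) * (η / 2) ^ 2 ≤ k * (η / 2) ^ 2 := by
        calc (G.card : ℝ) * (η / 2) ^ 2 = ∑ i ∈ G, (η / 2) ^ 2 := by simp
          _ ≤ ∑ i ∈ G, inner ℝ (e - c) (a i) ^ 2 := by
              refine Finset.sum_le_sum fun i hi => ?_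
              rw [← sq_abs (inner ℝ (e - c) (a i))]
              exact pow_le_pow_left₀ (by positivity) (Finset.mem_filter.1 hi).2 2
          _ ≤ ∑ i, inner ℝ (e - c) (a i) ^ 2 :=
              Finset.sum_le_sum_of_subset_of_nonneg (Finset.subset_univ _)
                fun i _ _ => sq_nonneg _
          _ ≤ U * ‖e - c‖ ^ 2 := hU _
          _ ≤ U * ε ^ 2 := by gcongr
          _ ≤ _ := hUk
      exact le_of_mul_le_mul_right h1 (by positivity)
    have hcard : k ≤ ((T \ (F ∪ G)).card : ℝ) := by
      have h1 : (T.card : ℝ) ≤ (T \ (F ∪ G)).card + (F.card + G.card) := by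
        have h2 := Finset.le_card_sdiff (F ∪ G) T
        have h3 := Finset.card_union_le F G
        have : T.card ≤ (T \ (F ∪ G)).card + (F.card + G.card) := by omega
        exact_mod_cast this
      have := hs c hc
      linarith
    calc k * (η / 2) ^ 2 ≤ ((T \ (F ∪ G)).card : ℝ) * (η / 2) ^ 2 := by gcongr
      _ = ∑ i ∈ T \ (F ∪ G), (η / 2) ^ 2 := by simp
      _ ≤ ∑ i ∈ T \ (F ∪ G), inner ℝ e (a i) ^ 2 := by
          refine Finset.sum_le_sum fun i hi => ?_
          simp only [hF, hG, Finset.mem_sdiff, Finset.mem_union, Finset.mem_filter,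
            Finset.mem_univ, true_and, not_or, not_le] at hi
          have h1 : inner ℝ c (a i) = inner ℝ e (a i) - inner ℝ (e - c) (a i) := by
            rw [inner_sub_left]; ring
          have h2 : η < |inner ℝ e (a i)| + |inner ℝ (e - c) (a i)| :=
            hi.2.1.trans_le (by rw [h1]; exact abs_sub _ _)
          rw [← sq_abs (inner ℝ e (a i))]
          exact pow_le_pow_left₀ (by positivity) (by linarith [hi.2.2]) 2
      _ ≤ _ := Finset.sum_le_sum_of_subset_of_nonneg Finset.sdiff_subset
          fun i _ _ => sq_nonneg _
  by_cases he : e = 0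
  · simp [he]
  have hne : ‖e‖ ≠ 0 := norm_ne_zero_iff.2 he
  have h1 := hunit (‖e‖⁻¹ • e) (by rw [norm_smul, norm_inv, norm_norm, inv_mul_cancel₀ hne])
  simp_rw [real_inner_smul_left, mul_pow] at h1
  rw [← Finset.mul_sum, inv_pow, inv_mul_eq_div, le_div_iff₀ (by positivity)] at h1
  exact h1

/-! ### The uniform distribution on the sphere and the Gaussian measure -/

lemma isProbabilityMeasure_uniformSphere {n : ℕ} (hn : 0 < n) :
    IsProbabilityMeasure (uniformSphere n) := by
  have : Nonempty (Fin n) := ⟨⟨0, hn⟩⟩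
  refine ⟨?_⟩
  rw [uniformSphere, Measure.smul_apply, smul_eq_mul]
  refine ENNReal.inv_mul_cancel ?_ (measure_ne_top _ _)
  exact Measure.measure_univ_ne_zero.2 (Measure.toSphere_ne_zero _)

/-- Lebesgue measure has the reciprocal Gaussian density with respect to the Gaussian measure. In
this direction the product formula involves integrals against probability measures only. -/
lemma withDensity_gaussianReal :
    (gaussianReal 0 1).withDensity
      (fun x => ENNReal.ofReal (√(2 * Real.pi) * Real.exp (x ^ 2 / 2))) = volume := by
  have h : (fun x : ℝ => ENNReal.ofReal (√(2 * Real.pi) * Real.exp (x ^ 2 / 2))) =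
      fun x => (gaussianPDF 0 1 x)⁻¹ := by
    funext x
    rw [gaussianPDF, ← ENNReal.ofReal_inv_of_pos (gaussianPDFReal_pos 0 1 x one_ne_zero),
      gaussianPDFReal, mul_inv, inv_inv, ← Real.exp_neg]
    simp [neg_div]
  rw [h, gaussianReal_of_var_ne_zero 0 one_ne_zero]
  exact withDensity_inv_same (measurable_gaussianPDF 0 1)
    (ae_of_all _ fun x => (gaussianPDF_pos 0 one_ne_zero x).ne')
    (ae_of_all _ fun x => gaussianPDF_ne_top)

lemma withDensity_pi_gaussianReal (n : ℕ) :
    (Measure.pi fun _ : Fin n => gaussianReal 0 1).withDensity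
      (fun x => ∏ i, ENNReal.ofReal (√(2 * Real.pi) * Real.exp (x i ^ 2 / 2))) = volume := by
  refine (Measure.pi_eq fun s hs => ?_).symm
  rw [withDensity_apply _ (MeasurableSet.univ_pi hs),
    ← lintegral_indicator (MeasurableSet.univ_pi hs)]
  have h : (Set.univ.pi s).indicator (fun x : Fin n → ℝ =>
      ∏ i, ENNReal.ofReal (√(2 * Real.pi) * Real.exp (x i ^ 2 / 2))) =
      fun x => ∏ i, (s i).indicator
        (fun x => ENNReal.ofReal (√(2 * Real.pi) * Real.exp (x ^ 2 / 2))) (x i) := by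
    funext x
    by_cases hx : x ∈ Set.univ.pi s
    · rw [Set.indicator_of_mem hx]
      exact Finset.prod_congr rfl fun i _ => (Set.indicator_of_mem (hx i trivial)
        (fun x => ENNReal.ofReal (√(2 * Real.pi) * Real.exp (x ^ 2 / 2)))).symm
    · rw [Set.indicator_of_notMem hx]
      obtain ⟨i, hi⟩ : ∃ i, x i ∉ s i := by simpa [Set.mem_pi] using hx
      exact (Finset.prod_eq_zero (Finset.mem_univ i) (Set.indicator_of_notMem hi _)).symm
  rw [h, lintegral_pi_prod (fun _ : Fin n => gaussianReal 0 1)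
    (f := fun i => (s i).indicator
      (fun x => ENNReal.ofReal (√(2 * Real.pi) * Real.exp (x ^ 2 / 2))))
    fun i => Measurable.indicator (by fun_prop) (hs i)]
  refine Finset.prod_congr rfl fun i _ => ?_
  rw [lintegral_indicator (hs i), ← withDensity_apply _ (hs i), withDensity_gaussianReal]

/-- The density of the standard Gaussian measure, in terms of integrals. -/
lemma lintegral_stdGaussian (n : ℕ) {F : EuclideanSpace ℝ (Fin n) → ℝ≥0∞} (hF : Measurable F) :
    ∫⁻ x, F x ∂(stdGaussian (EuclideanSpace ℝ (Fin n))) =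
      ∫⁻ x, ENNReal.ofReal ((√(2 * Real.pi) ^ n * Real.exp (‖x‖ ^ 2 / 2))⁻¹) * F x := by
  set k : (Fin n → ℝ) → ℝ≥0∞ :=
    fun x => ∏ i, ENNReal.ofReal (√(2 * Real.pi) * Real.exp (x i ^ 2 / 2)) with hk
  have hkm : Measurable k := by
    refine Finset.measurable_prod _ fun i _ => ?_
    fun_prop
  have hk' : ∀ x, k x = ENNReal.ofReal (√(2 * Real.pi) ^ n *
      Real.exp (‖(WithLp.toLp 2 x : EuclideanSpace ℝ (Fin n))‖ ^ 2 / 2)) := by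
    intro x
    simp only [hk]
    rw [← ENNReal.ofReal_prod_of_nonneg fun i _ => by positivity, Finset.prod_mul_distrib,
      ← Real.exp_sum, EuclideanSpace.real_norm_sq_eq, Finset.sum_div]
    simp
  have hpos : ∀ x : Fin n → ℝ, 0 < √(2 * Real.pi) ^ n *
      Real.exp (‖(WithLp.toLp 2 x : EuclideanSpace ℝ (Fin n))‖ ^ 2 / 2) := fun x => by positivity
  have hdens : Measure.pi (fun _ : Fin n => gaussianReal 0 1) =
      (volume : Measure (Fin n → ℝ)).withDensity fun x => (k x)⁻¹ := by
    rw [← withDensity_pi_gaussianReal n]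
    refine (withDensity_inv_same hkm (ae_of_all _ fun x => ?_) (ae_of_all _ fun x => ?_)).symm
    · rw [hk']; exact (ENNReal.ofReal_pos.2 (hpos x)).ne'
    · rw [hk']; exact ENNReal.ofReal_ne_top
  rw [← map_pi_eq_stdGaussian, lintegral_map hF (by fun_prop), hdens,
    lintegral_withDensity_eq_lintegral_mul (f := fun x => (k x)⁻¹) _ hkm.inv
      (g := fun x => F (WithLp.toLp 2 x)) (hF.comp (by fun_prop)),
    ← (PiLp.volume_preserving_toLp (Fin n)).lintegral_comp (by fun_prop)]
  refine lintegral_congr fun x => ?_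
  rw [ENNReal.ofReal_inv_of_pos (hpos x), ← hk' x]
  rfl

/-- The standard Gaussian vector is the product of a uniform random point of the sphere and an
independent random radius. -/
lemma exists_radial_law {n : ℕ} (hn : 0 < n) :
    ∃ ν : Measure ℝ, IsProbabilityMeasure ν ∧
      ∀ F : EuclideanSpace ℝ (Fin n) → ℝ≥0∞, Measurable F →
        ∫⁻ x, F x ∂(stdGaussian (EuclideanSpace ℝ (Fin n))) =
          ∫⁻ θ, ∫⁻ r, F (r • (θ : EuclideanSpace ℝ (Fin n))) ∂ν ∂(uniformSphere n) := by
  have hne : Nonempty (Fin n) := ⟨⟨0, hn⟩⟩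
  have := isProbabilityMeasure_uniformSphere hn
  let E := EuclideanSpace ℝ (Fin n)
  set S : Measure (Metric.sphere (0 : E) 1) := (volume : Measure E).toSphere with hS
  set Z := S Set.univ with hZ
  have hZ0 : Z ≠ 0 := Measure.measure_univ_ne_zero.2 (Measure.toSphere_ne_zero _)
  have hSZ : S = Z • uniformSphere n := by
    rw [uniformSphere, ← hS, ← hZ, smul_smul, ENNReal.mul_inv_cancel hZ0 (measure_ne_top _ _),
      one_smul]
  set g : ℝ → ℝ≥0∞ :=
    fun r => ENNReal.ofReal ((√(2 * Real.pi) ^ n * Real.exp (r ^ 2 / 2))⁻¹) with hg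
  have hgm : Measurable g := by fun_prop
  set τ : Measure (Set.Ioi (0 : ℝ)) := Measure.volumeIoiPow (Module.finrank ℝ E - 1) with hτ
  -- The radial density `Z r ^ (n - 1) g r`; its total mass is `1` by the case `F = 1` of the identity.
  set ν : Measure ℝ := (Z • τ.withDensity fun r => g r).map Subtype.val with hν
  have hmain : ∀ F : E → ℝ≥0∞, Measurable F → ∫⁻ x, F x ∂(stdGaussian E) =
      ∫⁻ θ, ∫⁻ r, F (r • (θ : E)) ∂ν ∂(uniformSphere n) := by
    intro F hF
    have hFθ : ∀ θ : Metric.sphere (0 : E) 1, Measurable fun r : ℝ => F (r • (θ : E)) :=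
      fun θ => hF.comp (by fun_prop)
    have hG : Measurable fun p : Metric.sphere (0 : E) 1 × Set.Ioi (0 : ℝ) =>
        g p.2 * F ((p.2 : ℝ) • (p.1 : E)) :=
      (hgm.comp (by fun_prop)).mul (hF.comp (by fun_prop))
    calc ∫⁻ x, F x ∂(stdGaussian E) = ∫⁻ x : E, g ‖x‖ * F x := lintegral_stdGaussian n hF
      _ = ∫⁻ x in ({0}ᶜ : Set E), g ‖x‖ * F x := by
          rw [restrict_compl_singleton]
      _ = ∫⁻ x : ({0}ᶜ : Set E), g ‖(x : E)‖ * F x ∂(volume.comap Subtype.val) :=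
          (lintegral_subtype_comap (measurableSet_singleton _).compl
            fun x => g ‖x‖ * F x).symm
      _ = ∫⁻ p, g p.2 * F ((p.2 : ℝ) • (p.1 : E)) ∂(S.prod τ) := by
          rw [← ((volume : Measure E).measurePreserving_homeomorphUnitSphereProd).lintegral_comp hG]
          refine lintegral_congr fun x => ?_
          have hx : ‖(x : E)‖ ≠ 0 := norm_ne_zero_iff.2 x.2
          simp [smul_smul, hx]
      _ = ∫⁻ θ, ∫⁻ r, g r * F ((r : ℝ) • (θ : E)) ∂τ ∂S := lintegral_prod _ hG.aemeasurable
      _ = Z * ∫⁻ θ, ∫⁻ r, g r * F ((r : ℝ) • (θ : E)) ∂τ ∂(uniformSphere n) := by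
          rw [hSZ, lintegral_smul_measure, smul_eq_mul]
      _ = ∫⁻ θ, Z * ∫⁻ r, g r * F ((r : ℝ) • (θ : E)) ∂τ ∂(uniformSphere n) :=
          (lintegral_const_mul _ hG.lintegral_prod_right').symm
      _ = _ := by
          refine lintegral_congr fun θ => ?_
          rw [hν, lintegral_map (hFθ θ) measurable_subtype_coe, lintegral_smul_measure,
            lintegral_withDensity_eq_lintegral_mul (f := fun r : Set.Ioi (0 : ℝ) => g r) _
              (hgm.comp measurable_subtype_coe)
              (g := fun r : Set.Ioi (0 : ℝ) => F ((r : ℝ) • (θ : E)))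
              ((hFθ θ).comp measurable_subtype_coe)]
          rfl
  refine ⟨ν, ⟨?_⟩, hmain⟩
  have h1 := hmain (fun _ => 1) measurable_const
  simpa using h1.symm

lemma lintegral_exp_sq_gaussianReal_le :
    ∫⁻ x, ENNReal.ofReal (Real.exp (x ^ 2 / 4)) ∂(gaussianReal 0 1) ≤ ENNReal.ofReal 2 := by
  rw [gaussianReal_of_var_ne_zero 0 one_ne_zero,
    lintegral_withDensity_eq_lintegral_mul _ (measurable_gaussianPDF 0 1) (by fun_prop)]
  have h : ∀ x : ℝ, (gaussianPDF 0 1 * fun x => ENNReal.ofReal (Real.exp (x ^ 2 / 4))) x =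
      ENNReal.ofReal ((√(2 * Real.pi))⁻¹ * Real.exp (-(1 / 4) * x ^ 2)) := by
    intro x
    rw [Pi.mul_apply, gaussianPDF, ← ENNReal.ofReal_mul (gaussianPDFReal_nonneg 0 1 x),
      gaussianPDFReal, mul_assoc, ← Real.exp_add]
    congr 3
    · simp
    · simp; ring
  simp_rw [h]
  rw [← ofReal_integral_eq_lintegral_ofReal
    ((integrable_exp_neg_mul_sq (by norm_num)).const_mul _) (ae_of_all _ fun x => by positivity),
    integral_const_mul, integral_gaussian]
  refine ENNReal.ofReal_le_ofReal ?_
  rw [inv_mul_le_iff₀ (by positivity)]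
  refine Real.sqrt_le_iff.2 ⟨by positivity, ?_⟩
  rw [mul_pow, Real.sq_sqrt (by positivity)]
  linarith [Real.pi_pos]

lemma gaussianReal_abs_le_le (t : ℝ) :
    gaussianReal 0 1 {x | |x| ≤ t} ≤ ENNReal.ofReal (2 * t) := by
  have hset : {x : ℝ | |x| ≤ t} = Set.Icc (-t) t := by ext x; simp [abs_le]
  rw [gaussianReal_apply 0 one_ne_zero, hset]
  calc ∫⁻ x in Set.Icc (-t) t, gaussianPDF 0 1 x ≤ ∫⁻ x in Set.Icc (-t) t, 1 := by
        refine lintegral_mono fun x => ?_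
        rw [gaussianPDF, ENNReal.ofReal_le_one, gaussianPDFReal]
        refine mul_le_one₀ (inv_le_one_of_one_le₀ ?_) (Real.exp_pos _).le
          (Real.exp_le_one_iff.2 ?_)
        · refine Real.one_le_sqrt.2 ?_
          simp only [NNReal.coe_one, mul_one]
          linarith [Real.pi_gt_three]
        · exact div_nonpos_of_nonpos_of_nonneg (neg_nonpos.2 (sq_nonneg _)) (by positivity)
    _ = ENNReal.ofReal (2 * t) := by
        rw [setLIntegral_one, Real.volume_Icc]
        congr 1; ring

lemma lintegral_sq_gaussianReal :
    ∫⁻ x, ENNReal.ofReal (x ^ 2) ∂(gaussianReal 0 1) = 1 := by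
  have hint : Integrable (fun x : ℝ => x ^ 2) (gaussianReal 0 1) :=
    (memLp_id_gaussianReal 2).integrable_sq
  rw [← ofReal_integral_eq_lintegral_ofReal hint (ae_of_all _ fun x => sq_nonneg x)]
  have h := variance_of_integral_eq_zero (X := fun x : ℝ => x) (μ := gaussianReal 0 1)
    (by fun_prop) integral_id_gaussianReal
  rw [variance_fun_id_gaussianReal] at h
  simp [← h]

lemma lintegral_norm_sq_stdGaussian (n : ℕ) :
    ∫⁻ x, ENNReal.ofReal (‖x‖ ^ 2) ∂(stdGaussian (EuclideanSpace ℝ (Fin n))) = n := by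
  rw [← map_pi_eq_stdGaussian, lintegral_map (by fun_prop) (by fun_prop)]
  simp_rw [EuclideanSpace.real_norm_sq_eq]
  simp_rw [fun x : Fin n → ℝ => ENNReal.ofReal_sum_of_nonneg (s := Finset.univ)
    (f := fun i => x i ^ 2) fun i _ => sq_nonneg _]
  rw [lintegral_finsetSum _ fun i _ => by fun_prop]
  have h : ∀ i : Fin n, ∫⁻ x : Fin n → ℝ, ENNReal.ofReal (x i ^ 2)
      ∂(Measure.pi fun _ => gaussianReal 0 1) = 1 := fun i => by
    rw [(measurePreserving_eval (fun _ : Fin n => gaussianReal 0 1) i).lintegral_comp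
      (f := fun x => ENNReal.ofReal (x ^ 2)) (by fun_prop), lintegral_sq_gaussianReal]
  simp [h]

lemma map_inner_stdGaussian {n : ℕ} {e : EuclideanSpace ℝ (Fin n)} (he : ‖e‖ = 1) :
    (stdGaussian (EuclideanSpace ℝ (Fin n))).map (fun x => inner ℝ e x) = gaussianReal 0 1 := by
  have h := IsGaussian.map_eq_gaussianReal (μ := stdGaussian (EuclideanSpace ℝ (Fin n)))
    (innerSL ℝ e)
  rw [integral_strongDual_stdGaussian, variance_dual_stdGaussian, innerSL_apply_norm, he] at h
  simpa using h

/-! ### Random matrices with independent uniform rows -/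

/-- Jensen's inequality for `s ↦ exp (v s)`, without integrability assumptions; the exponential
lies above its tangent at the mean `n`. -/
lemma ofReal_exp_mean_le {ν : Measure ℝ} [IsProbabilityMeasure ν] {n : ℕ}
    (hν : ∫⁻ r, ENNReal.ofReal (r ^ 2) ∂ν = n) {v : ℝ} (hv : 0 ≤ v) :
    ENNReal.ofReal (Real.exp (n * v)) ≤ ∫⁻ r, ENNReal.ofReal (Real.exp (r ^ 2 * v)) ∂ν := by
  set A := Real.exp (n * v) with hA
  have hA0 : 0 < A := Real.exp_pos _
  have hpt : ∀ r : ℝ, ENNReal.ofReal A + ENNReal.ofReal (A * v) * ENNReal.ofReal (r ^ 2) ≤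
      ENNReal.ofReal (Real.exp (r ^ 2 * v)) + ENNReal.ofReal (A * v) * n := by
    intro r
    rw [← ENNReal.ofReal_natCast, ← ENNReal.ofReal_mul (by positivity),
      ← ENNReal.ofReal_mul (by positivity), ← ENNReal.ofReal_add hA0.le (by positivity),
      ← ENNReal.ofReal_add (Real.exp_pos _).le (by positivity)]
    refine ENNReal.ofReal_le_ofReal ?_
    have h1 : Real.exp (r ^ 2 * v) = A * Real.exp (r ^ 2 * v - n * v) := by
      rw [hA, ← Real.exp_add]; congr 1; ring
    have h2 := mul_le_mul_of_nonneg_left (Real.add_one_le_exp (r ^ 2 * v - n * v)) hA0.le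
    rw [h1]
    linarith
  have hint := lintegral_mono (μ := ν) hpt
  rw [lintegral_add_left measurable_const, lintegral_add_right _ measurable_const,
    lintegral_const_mul _ (by fun_prop), hν] at hint
  simp only [lintegral_const, measure_univ, mul_one] at hint
  exact (ENNReal.add_le_add_iff_right (ENNReal.mul_ne_top ENNReal.ofReal_ne_top
    (ENNReal.natCast_ne_top n))).1 hint

/-- The coordinates of a uniform random point of the sphere are subgaussian at scale `1 / √n`:
averaging over the radius of a Gaussian vector only increases the exponential moment. -/
lemma lintegral_exp_inner_sq_uniformSphere_le {n : ℕ} (hn : 0 < n)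
    {e : EuclideanSpace ℝ (Fin n)} (he : ‖e‖ = 1) :
    ∫⁻ θ, ENNReal.ofReal (Real.exp (n * (inner ℝ e (θ : EuclideanSpace ℝ (Fin n)) ^ 2 / 4)))
      ∂(uniformSphere n) ≤ ENNReal.ofReal 2 := by
  have := isProbabilityMeasure_uniformSphere hn
  obtain ⟨ν, hν, hpolar⟩ := exists_radial_law hn
  have hmean : ∫⁻ r, ENNReal.ofReal (r ^ 2) ∂ν = n := by
    have h := hpolar (fun x => ENNReal.ofReal (‖x‖ ^ 2)) (by fun_prop)
    rw [lintegral_norm_sq_stdGaussian] at h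
    simpa [norm_smul] using h.symm
  calc _ ≤ ∫⁻ θ, ∫⁻ r, ENNReal.ofReal (Real.exp
          (inner ℝ e (r • (θ : EuclideanSpace ℝ (Fin n))) ^ 2 / 4)) ∂ν ∂(uniformSphere n) := by
        refine lintegral_mono fun θ => ?_
        refine (ofReal_exp_mean_le hmean (by positivity)).trans_eq (lintegral_congr fun r => ?_)
        rw [inner_smul_right]
        congr 2
        ring
    _ = ∫⁻ x, ENNReal.ofReal (Real.exp (inner ℝ e x ^ 2 / 4))
          ∂(stdGaussian (EuclideanSpace ℝ (Fin n))) := (hpolar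
        (fun x => ENNReal.ofReal (Real.exp (inner ℝ e x ^ 2 / 4))) (by fun_prop)).symm
    _ = ∫⁻ x, ENNReal.ofReal (Real.exp (x ^ 2 / 4)) ∂(gaussianReal 0 1) := by
        rw [← map_inner_stdGaussian he, lintegral_map (by fun_prop) (by fun_prop)]
    _ ≤ _ := lintegral_exp_sq_gaussianReal_le

/-- Anticoncentration on the sphere: a coordinate of a Gaussian vector is unlikely to be small,
and its norm is unlikely to exceed `R √n`. -/
lemma uniformSphere_abs_inner_le {n : ℕ} (hn : 0 < n) {e : EuclideanSpace ℝ (Fin n)}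
    (he : ‖e‖ = 1) {ε R : ℝ} (hε : 0 ≤ ε) (hR : 0 < R) :
    uniformSphere n {θ | |inner ℝ e (θ : EuclideanSpace ℝ (Fin n))| ≤ ε / √n} ≤
      ENNReal.ofReal (2 * (ε * R) + 1 / R ^ 2) := by
  have := isProbabilityMeasure_uniformSphere hn
  have hnR : (0 : ℝ) < n := by exact_mod_cast hn
  obtain ⟨ν, hν, hpolar⟩ := exists_radial_law hn
  let E := EuclideanSpace ℝ (Fin n)
  set S₁ : Set E := {x | |inner ℝ e x| ≤ ε * R} with hS₁
  set S₂ : Set E := {x | ENNReal.ofReal (R ^ 2 * n) ≤ ENNReal.ofReal (‖x‖ ^ 2)} with hS₂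
  have hm₁ : MeasurableSet S₁ := measurableSet_le (by fun_prop) measurable_const
  have hm₂ : MeasurableSet S₂ := measurableSet_le measurable_const (by fun_prop)
  have hγ₁ : stdGaussian E S₁ ≤ ENNReal.ofReal (2 * (ε * R)) := by
    have h := gaussianReal_abs_le_le (ε * R)
    rwa [← map_inner_stdGaussian he, Measure.map_apply (by fun_prop)
      (measurableSet_le (by fun_prop) measurable_const)] at h
  have hγ₂ : stdGaussian E S₂ ≤ ENNReal.ofReal (1 / R ^ 2) := by
    refine (meas_ge_le_lintegral_div (by fun_prop) (ENNReal.ofReal_pos.2 (by positivity)).ne'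
      ENNReal.ofReal_ne_top).trans ?_
    rw [lintegral_norm_sq_stdGaussian, ← ENNReal.ofReal_natCast,
      ← ENNReal.ofReal_div_of_pos (by positivity)]
    refine ENNReal.ofReal_le_ofReal (le_of_eq ?_)
    field_simp
  have hm : MeasurableSet {θ : Metric.sphere (0 : E) 1 | |inner ℝ e (θ : E)| ≤ ε / √n} :=
    measurableSet_le (by fun_prop) measurable_const
  calc uniformSphere n {θ | |inner ℝ e (θ : E)| ≤ ε / √n}
      = ∫⁻ θ, {θ : Metric.sphere (0 : E) 1 | |inner ℝ e (θ : E)| ≤ ε / √n}.indicator 1 θ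
          ∂(uniformSphere n) := (lintegral_indicator_one hm).symm
    _ ≤ ∫⁻ θ, ∫⁻ r, (S₁ ∪ S₂).indicator 1 (r • (θ : E)) ∂ν ∂(uniformSphere n) := by
        refine lintegral_mono fun θ => ?_
        refine Set.indicator_apply_le' (fun hθ => ?_) fun _ => zero_le
        have hall : ∀ r : ℝ, (S₁ ∪ S₂).indicator (1 : E → ℝ≥0∞) (r • (θ : E)) = 1 := by
          intro r
          refine Set.indicator_of_mem ?_ _
          by_cases hr : R ^ 2 * n ≤ r ^ 2
          · right
            have : ‖r • (θ : E)‖ ^ 2 = r ^ 2 := by simp [norm_smul]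
            rw [hS₂, Set.mem_ofPred_eq, this]
            exact ENNReal.ofReal_le_ofReal hr
          · left
            have hr' : |r| ≤ R * √n := by
              refine abs_le_of_sq_le_sq ?_ (by positivity)
              rw [mul_pow, Real.sq_sqrt hnR.le]
              exact (not_le.1 hr).le
            have hθ' : |inner ℝ e (θ : E)| ≤ ε / √n := hθ
            rw [hS₁, Set.mem_ofPred_eq, inner_smul_right, abs_mul]
            calc |r| * |inner ℝ e (θ : E)| ≤ R * √n * (ε / √n) := by gcongr
              _ = ε * R := by field_simp
        simp [hall]
    _ = stdGaussian E (S₁ ∪ S₂) := by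
        rw [← hpolar _ (measurable_one.indicator (hm₁.union hm₂)),
          lintegral_indicator_one (hm₁.union hm₂)]
    _ ≤ stdGaussian E S₁ + stdGaussian E S₂ := measure_union_le _ _
    _ ≤ ENNReal.ofReal (2 * (ε * R)) + ENNReal.ofReal (1 / R ^ 2) := add_le_add hγ₁ hγ₂
    _ = _ := (ENNReal.ofReal_add (by positivity) (by positivity)).symm

lemma two_mul_exp_le (t : ℝ) : Real.exp (-t) * 2 ≤ Real.exp (1 - t) := by
  rw [sub_eq_add_neg, Real.exp_add, mul_comm]
  gcongr
  linarith [Real.add_one_le_exp 1]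

/-- A union bound over at most `exp (d m)` events of probability at most `exp (-l m)`. -/
lemma measure_exists_mem_finset_le {Ω ι : Type*} [MeasurableSpace Ω] {μ : Measure Ω}
    {s : Finset ι} {d l : ℝ} {m : ℕ} (hs : (s.card : ℝ) ≤ Real.exp (d * m)) {B : ι → Set Ω}
    (hB : ∀ c ∈ s, μ (B c) ≤ ENNReal.ofReal (Real.exp (-l) ^ m)) :
    μ {a | ∃ c ∈ s, a ∈ B c} ≤ ENNReal.ofReal (Real.exp (-((l - d) * m))) := by
  have hset : {a | ∃ c ∈ s, a ∈ B c} = ⋃ c ∈ s, B c := by ext a; simp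
  rw [hset]
  calc μ (⋃ c ∈ s, B c) ≤ ∑ c ∈ s, μ (B c) := measure_biUnion_finset_le _ _
    _ ≤ ∑ c ∈ s, ENNReal.ofReal (Real.exp (-l) ^ m) := Finset.sum_le_sum hB
    _ = ENNReal.ofReal (s.card * Real.exp (-l) ^ m) := by
        rw [Finset.sum_const, nsmul_eq_mul, ENNReal.ofReal_mul (Nat.cast_nonneg _),
          ENNReal.ofReal_natCast]
    _ ≤ ENNReal.ofReal (Real.exp (d * m) * Real.exp (-l) ^ m) := by gcongr
    _ = _ := by
        rw [← Real.exp_nat_mul, ← Real.exp_add]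
        congr 2
        ring

/-- With overwhelming probability the Gram matrix `∑ aᵢ aᵢᵀ` has norm of order `m / n`. -/
lemma pi_not_sum_inner_sq_le {m n : ℕ} (hn : 0 < n) (hnm : n ≤ m) :
    Measure.pi (fun _ : Fin m => uniformSphere n)
      {a | ¬ ∀ e, ∑ i, inner ℝ e (a i : EuclideanSpace ℝ (Fin n)) ^ 2 ≤
        80 * (m / n) * ‖e‖ ^ 2} ≤ ENNReal.ofReal (Real.exp (-m)) := by
  have := isProbabilityMeasure_uniformSphere hn
  have hnR : (0 : ℝ) < n := by exact_mod_cast hn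
  obtain ⟨s, hs1, hscard, hnet⟩ :=
    exists_net (E := EuclideanSpace ℝ (Fin n)) (ε := 1 / 2) (by norm_num)
  have hcard : (s.card : ℝ) ≤ Real.exp (2 * m) := by
    refine hscard.trans ?_
    have h5 : (1 + 2 / (1 / 2) : ℝ) ≤ Real.exp 2 := by
      have h := Real.exp_one_gt_d9
      have : Real.exp 2 = Real.exp 1 * Real.exp 1 := by rw [← Real.exp_add]; norm_num
      rw [this]
      nlinarith
    rw [finrank_euclideanSpace_fin]
    calc ((1 + 2 / (1 / 2) : ℝ)) ^ n ≤ Real.exp 2 ^ n := by gcongr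
      _ ≤ Real.exp 2 ^ m := pow_le_pow_right₀ (Real.one_le_exp (by norm_num)) hnm
      _ = Real.exp (2 * m) := by rw [← Real.exp_nat_mul, mul_comm]
  have hunion := measure_exists_mem_finset_le (μ := Measure.pi fun _ : Fin m => uniformSphere n)
    (l := 4) (B := fun c => {a | 5 * (m : ℝ) ≤
      ∑ i, n * (inner ℝ c (a i : EuclideanSpace ℝ (Fin n)) ^ 2 / 4)}) hcard fun c hc => by
        refine (pi_le_sum_le (f := fun θ : Metric.sphere (0 : EuclideanSpace ℝ (Fin n)) 1 =>
          n * (inner ℝ c (θ : EuclideanSpace ℝ (Fin n)) ^ 2 / 4)) (by fun_prop) zero_le_two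
          (lintegral_exp_inner_sq_uniformSphere_le hn (hs1 c hc)) 5 m).trans ?_
        gcongr
        exact (two_mul_exp_le 5).trans_eq (by norm_num)
  refine (measure_mono fun a ha => ?_).trans (hunion.trans ?_)
  · rw [Set.mem_ofPred_eq] at ha ⊢
    contrapose! ha
    intro e
    have hL := sum_inner_sq_le_of_net (a := fun i => (a i : EuclideanSpace ℝ (Fin n)))
      (L := 20 * (m / n)) hnet (fun c hc => ?_) (by positivity) e
    · exact hL.trans_eq (by ring)
    · have h := ha c hc
      rw [Set.mem_ofPred_eq, not_le, ← Finset.mul_sum, ← Finset.sum_div] at h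
      rw [← mul_div_assoc, le_div_iff₀ hnR]
      linarith
  · refine ENNReal.ofReal_le_ofReal (Real.exp_le_exp.2 ?_)
    have : (0 : ℝ) ≤ m := Nat.cast_nonneg m
    linarith

/-- For a fixed unit vector `c`, only a small proportion of the numbers `⟨c, aᵢ⟩` is much smaller
than `1 / √n`, with overwhelming probability. -/
lemma pi_card_abs_inner_le {m n : ℕ} (hn : 0 < n) {q ε : ℝ} (hq : 0 < q)
    {c : EuclideanSpace ℝ (Fin n)}
    (hp : uniformSphere n {θ | |inner ℝ c (θ : EuclideanSpace ℝ (Fin n))| ≤ ε / √n} ≤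
      ENNReal.ofReal (Real.exp (-(16 / q)))) :
    Measure.pi (fun _ : Fin m => uniformSphere n)
      {a | q / 4 * m ≤ ((Finset.univ.filter fun i =>
        |inner ℝ c (a i : EuclideanSpace ℝ (Fin n))| ≤ ε / √n).card : ℝ)} ≤
      ENNReal.ofReal (Real.exp (-3) ^ m) := by
  have := isProbabilityMeasure_uniformSphere hn
  set A := {θ : Metric.sphere (0 : EuclideanSpace ℝ (Fin n)) 1 |
    |inner ℝ c (θ : EuclideanSpace ℝ (Fin n))| ≤ ε / √n} with hA
  have hAm : MeasurableSet A := measurableSet_le (by fun_prop) measurable_const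
  -- The exponential moment of `16 / q` times the indicator of `A` is at most `2`.
  have hK : ∫⁻ θ, ENNReal.ofReal (Real.exp (A.indicator (fun _ => 16 / q) θ))
      ∂(uniformSphere n) ≤ ENNReal.ofReal 2 := by
    calc _ ≤ ∫⁻ θ, (1 + A.indicator (fun _ => ENNReal.ofReal (Real.exp (16 / q))) θ)
          ∂(uniformSphere n) := by
          refine lintegral_mono fun θ => ?_
          by_cases hθ : θ ∈ A <;> simp [hθ]
      _ = 1 + ENNReal.ofReal (Real.exp (16 / q)) * uniformSphere n A := by
          rw [lintegral_add_left measurable_const, lintegral_indicator_const hAm]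
          simp
      _ ≤ 1 + ENNReal.ofReal (Real.exp (16 / q)) * ENNReal.ofReal (Real.exp (-(16 / q))) := by
          gcongr
      _ = ENNReal.ofReal 2 := by
          rw [← ENNReal.ofReal_mul (Real.exp_pos _).le, ← Real.exp_add, add_neg_cancel,
            Real.exp_zero, ENNReal.ofReal_one]
          norm_num
  have h := pi_le_sum_le (measurable_const.indicator hAm) zero_le_two hK 4 m
  refine (measure_mono fun a ha => ?_).trans (h.trans ?_)
  · rw [Set.mem_ofPred_eq] at ha ⊢
    have hsum : ∑ i, A.indicator (fun _ => 16 / q) (a i) = ((Finset.univ.filter fun i =>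
        |inner ℝ c (a i : EuclideanSpace ℝ (Fin n))| ≤ ε / √n).card : ℝ) * (16 / q) := by
      simp only [Set.indicator_apply, hA, Set.mem_ofPred_eq]
      rw [← Finset.sum_filter, Finset.sum_const, nsmul_eq_mul]
    rw [hsum]
    calc 4 * (m : ℝ) = q / 4 * m * (16 / q) := by field_simp; ring
      _ ≤ _ := by gcongr
  · gcongr
    exact (two_mul_exp_le 4).trans_eq (by norm_num)

/-- It is exponentially unlikely that the Gram matrix of all rows has norm of order `m / n` and yet
some family of at least `3 q m / 4` rows has a Gram matrix with a much smaller eigenvalue. The norm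
bound is what carries the count of small inner products from the net to all unit vectors. -/
lemma pi_not_le_sum_inner_sq {m n : ℕ} (hn : 0 < n) {q p R ε₀ ε : ℝ} (hq0 : 0 < q)
    (hp : p = Real.exp (-(16 / q))) (hR : R = √(2 / p)) (hε₀ : ε₀ = p / (4 * R))
    (hε : 0 < ε) (hε2 : 80 * ε ^ 2 ≤ q / 4 * (ε₀ / 2) ^ 2) (hnm : (1 + 2 / ε) * n ≤ m) :
    Measure.pi (fun _ : Fin m => uniformSphere n)
      {a | (∀ e, ∑ i, inner ℝ e (a i : EuclideanSpace ℝ (Fin n)) ^ 2 ≤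
          80 * (m / n) * ‖e‖ ^ 2) ∧
        ¬ ∀ T : Finset (Fin m), 3 / 4 * q * m ≤ T.card → ∀ e,
          q * ε₀ ^ 2 / 16 * (m / n) * ‖e‖ ^ 2 ≤
            ∑ i ∈ T, inner ℝ e (a i : EuclideanSpace ℝ (Fin n)) ^ 2} ≤
      ENNReal.ofReal (Real.exp (-m)) := by
  have hnR : (0 : ℝ) < n := by exact_mod_cast hn
  have hp0 : 0 < p := hp ▸ Real.exp_pos _
  have hR0 : 0 < R := by rw [hR]; positivity
  have hε₀0 : 0 < ε₀ := by rw [hε₀]; positivity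
  obtain ⟨s, hs1, hscard, hnet⟩ := exists_net (E := EuclideanSpace ℝ (Fin n)) hε
  have hcard : (s.card : ℝ) ≤ Real.exp (1 * m) := by
    refine hscard.trans ?_
    rw [finrank_euclideanSpace_fin]
    calc (1 + 2 / ε) ^ n ≤ Real.exp (1 + 2 / ε) ^ n := by
          gcongr
          linarith [Real.add_one_le_exp (1 + 2 / ε)]
      _ = Real.exp ((1 + 2 / ε) * n) := by rw [← Real.exp_nat_mul, mul_comm]
      _ ≤ _ := Real.exp_le_exp.2 (by linarith)
  -- The choice of `R` and `ε₀` splits the probability `p` evenly.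
  have hsmall : 2 * (ε₀ * R) + 1 / R ^ 2 = p := by
    have h1 : R ^ 2 = 2 / p := by rw [hR, Real.sq_sqrt (by positivity)]
    have h2 : ε₀ * R = p / 4 := by rw [hε₀]; field_simp
    rw [h1, h2]
    field_simp
    norm_num
  have hunion := measure_exists_mem_finset_le (μ := Measure.pi fun _ : Fin m => uniformSphere n)
    (l := 3) (B := fun c => {a | q / 4 * m ≤ ((Finset.univ.filter fun i =>
        |inner ℝ c (a i : EuclideanSpace ℝ (Fin n))| ≤ ε₀ / √n).card : ℝ)}) hcard fun c hc =>
    pi_card_abs_inner_le hn hq0 (by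
      rw [← hp, ← hsmall]
      exact uniformSphere_abs_inner_le hn (hs1 c hc) hε₀0.le hR0)
  refine (measure_mono fun a ha => ?_).trans (hunion.trans ?_)
  · rw [Set.mem_ofPred_eq] at ha ⊢
    obtain ⟨hup, hlow⟩ := ha
    contrapose! hlow
    intro T hT e
    have hk : q / 4 * m * (ε₀ / √n / 2) ^ 2 = q * ε₀ ^ 2 / 16 * (m / n) := by
      rw [div_pow, div_pow, Real.sq_sqrt hnR.le]
      field_simp
      ring
    have h := le_sum_inner_sq_of_net (a := fun i => (a i : EuclideanSpace ℝ (Fin n)))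
      (U := 80 * (m / n)) (k := q / 4 * m) (η := ε₀ / √n) (by positivity) (by positivity) hnet hup
      ?_ (fun c hc => ?_) (T := T) (by linarith) e
    · rwa [hk] at h
    · rw [hk]
      calc 80 * ((m : ℝ) / n) * ε ^ 2 = 80 * ε ^ 2 * (m / n) := by ring
        _ ≤ q / 4 * (ε₀ / 2) ^ 2 * (m / n) := by gcongr
        _ = _ := by ring
    · have := hlow c hc
      rw [Set.mem_ofPred_eq, not_le] at this
      exact this.le
  · refine ENNReal.ofReal_le_ofReal (Real.exp_le_exp.2 ?_)
    have : (0 : ℝ) ≤ m := Nat.cast_nonneg m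
    linarith

end QuantileKaczmarz

theorem mainTheorem2 (q : ℝ) (hq0 : 0 < q) (hq1 : q < 1) :
    ∃ δ : ℝ, 0 < δ ∧ ∃ (ρ : ℝ) (N : ℕ) (C c : ℝ), 0 < C ∧ 0 < c ∧
      ∀ m n : ℕ, N ≤ n → ρ * n ≤ m →
        Measure.pi (fun _ : Fin m => QuantileKaczmarz.uniformSphere n)
            {a | ¬ ∀ β : ℝ, 0 ≤ β → β ≤ δ →
              QuantileKaczmarz.Converges q β (fun i => (a i : EuclideanSpace ℝ (Fin n)))} ≤
          ENNReal.ofReal (C * Real.exp (-(c * m))) := by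
  obtain ⟨p, hp⟩ : ∃ p, p = Real.exp (-(16 / q)) := ⟨_, rfl⟩
  obtain ⟨R, hR⟩ : ∃ R, R = √(2 / p) := ⟨_, rfl⟩
  -- A single row has `|⟨e, aᵢ⟩| ≤ ε₀ / √n` with probability at most `p`.
  obtain ⟨ε₀, hε₀⟩ : ∃ ε₀, ε₀ = p / (4 * R) := ⟨_, rfl⟩
  have hp0 : 0 < p := hp ▸ Real.exp_pos _
  have hR0 : 0 < R := by rw [hR]; positivity
  have hε₀0 : 0 < ε₀ := by rw [hε₀]; positivity
  obtain ⟨κ, hκ⟩ : ∃ κ, κ = q * ε₀ ^ 2 / 16 := ⟨_, rfl⟩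
  have hκ0 : 0 < κ := by rw [hκ]; positivity
  -- The mesh of the net for which perturbing a net point spoils at most `q m / 4` rows.
  obtain ⟨ε, hε⟩ : ∃ ε, ε = ε₀ * q / 40 := ⟨_, rfl⟩
  have hε0 : 0 < ε := by rw [hε]; positivity
  have hε2 : 80 * ε ^ 2 ≤ q / 4 * (ε₀ / 2) ^ 2 := by
    have h : 80 * ε ^ 2 = q * ε₀ ^ 2 / 20 * q := by rw [hε]; ring
    have h2 : q * ε₀ ^ 2 / 20 * q ≤ q * ε₀ ^ 2 / 20 * 1 := by gcongr
    nlinarith [mul_pos hq0 (pow_pos hε₀0 2)]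
  obtain ⟨D, hD⟩ : ∃ D, D = (1 + 4 * 80 / κ) * (2 * 80) := ⟨_, rfl⟩
  have hD0 : 0 < D := by rw [hD]; positivity
  have h1q : 0 < 1 - q := by linarith
  obtain ⟨δ, hδ⟩ : ∃ δ, δ = min (min (q / 4) ((1 - q) / 2)) (κ / 4 * (1 - q) / D) := ⟨_, rfl⟩
  have hδ0 : 0 < δ := by rw [hδ]; positivity
  have hδq : δ ≤ q / 4 := by rw [hδ]; exact (min_le_left _ _).trans (min_le_left _ _)
  have hδ1 : δ ≤ (1 - q) / 2 := by rw [hδ]; exact (min_le_left _ _).trans (min_le_right _ _)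
  have hδM : δ * (1 + 4 * 80 / κ) * (2 * 80) ≤ κ / 4 * (1 - q) := by
    have : δ ≤ κ / 4 * (1 - q) / D := by rw [hδ]; exact min_le_right _ _
    rw [le_div_iff₀ hD0, hD] at this
    linarith
  refine ⟨δ, hδ0, 1 + 2 / ε, 1, 2, 1, two_pos, one_pos, fun m n hn hmn => ?_⟩
  have hn0 : 0 < n := hn
  have hnR : (0 : ℝ) < n := by exact_mod_cast hn0
  have hnm : n ≤ m := by
    have h1 : (0 : ℝ) < 2 / ε * n := by positivity
    have : (n : ℝ) ≤ m := by linarith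
    exact_mod_cast this
  refine (measure_mono fun a ha => ?_).trans ((measure_union_le _ _).trans
    ((add_le_add (QuantileKaczmarz.pi_not_sum_inner_sq_le hn0 hnm)
      (QuantileKaczmarz.pi_not_le_sum_inner_sq hn0 hq0 hp hR hε₀ hε0 hε2 hmn)).trans_eq ?_))
  · rw [Set.mem_union, Set.mem_ofPred_eq, Set.mem_ofPred_eq]
    by_contra! hcon
    refine ha fun β _ hβ => ?_
    refine QuantileKaczmarz.converges_of_bounds hq0 hq1 (hn0.trans_le hnm) hn0
      (by norm_num : (0 : ℝ) < 80) hκ0 hδ0.le hδq hδ1 hδM (fun i => by simp) hcon.1 ?_ hβ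
    rw [hκ]
    exact hcon.2 hcon.1
  · rw [← ENNReal.ofReal_add (Real.exp_pos _).le (Real.exp_pos _).le]
    congr 1
    rw [one_mul]
    ring
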